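/- For $\lambda\in\mathbb C\setminus\{0\}$ let $f_\lambda(z)=\lambda\tan z$. A periodic cycle of $f_\lambda$ of exact period $p$ is attracting if its multiplier $(f_\lambda^{p})'(z)$ has modulus less than $1$. Let $\mathcal H$ be the set of $\lambda\ne 0$ for which $f_\lambda$ has an attracting periodic cycle; the connected components of $\mathcal H$ are called hyperbolic components. An asymptotic value of $f_\lambda$ is a limit $\lim_{t\to\infty}f_\lambda(\alpha(t))\in\mathbb C$ along a path $\alpha$ with $|\alpha(t)|\to\infty$ (these are the two points $\pm\lambda i$). (1) There is a hyperbolic component $\Omega_1$ containing the ray $\{\lambda\in\mathbb R:\lambda>1\}$. For every $\lambda\in\Omega_1$ the map $f_\lambda$ has exactly two distinct attracting fixed points, and $\Omega_1$ is the only hyperbolic component containing a parameter for which $f_\lambda$ has (at least) two distinct attracting fixed points. (2) There is a hyperbolic component $\Omega_2$ containing the ray $\{\lambda\in\mathbb R:\lambda<-1\}$. For every $\lambda\in\Omega_2$ the map $f_\lambda$ has a single attracting cycle; it has period two, and the orbits of both asymptotic values converge to it. Moreover $\Omega_2$ is the only hyperbolic component containing a parameter for which $f_\lambda$ has an attracting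 cycle of period two to which the orbits of both asymptotic values converge. (3) The boundaries of $\Omega_1$ and $\Omega_2$ in $\mathbb C$ are curves (continuous images of $\mathbb R$) whose two ends follow the two curves $t\pm i e^{|2t|}$, with $t=\operatorname{Re}\lambda\to+\infty$ for $\Omega_1$ and $t=\operatorname{Re}\lambda\to-\infty$ for $\Omega_2$, in the sense of order of growth. That is, for each $j\in\{1,2\}$ there is a continuous $\gamma:\mathbb R\to\mathbb C$ with $\gamma(\mathbb R)=\partial\Omega_j$ such that, as $s\to+\infty$ and as $s\to-\infty$, $\operatorname{Re}\gamma(s)\to+\infty$ if $j=1$ and $\operatorname{Re}\gamma(s)\to-\infty$ if $j=2$, and there are constants $c,C>0$ with $$c\,e^{|2\operatorname{Re}\gamma(s)|}\le \operatorname{Im}\gamma(s)\le C\,e^{|2\operatorname{Re}\gamma(s)|}\quad\text{for all sufficiently large } s,$$ $$c\,e^{|2\operatorname{Re}\gamma(s)|}\le -\operatorname{Im}\gamma(s)\le C\,e^{|2\operatorname{Re}\gamma(s)|}\quad\text{for all sufficiently small } s.$$ In particular $\log|\operatorname{Im}\lambda|\sim|2\operatorname{Re}\lambda|$ as $\lambda\to\infty$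 along either boundary curve. -/

import Mathlib

open Filter Topology

/-- The tangent map `f_λ(z) = λ tan z`. Its poles are the zeros of `cos`; the value that Lean gives
it there is never used, because orbits are required below to avoid the poles. -/
noncomputable def tanFamily (lam : ℂ) (z : ℂ) : ℂ := lam * Complex.tan z

/-- All iterates of `f_λ` are defined and finite at `z`: the orbit of `z` never meets a pole. -/
def OrbitDefined (lam z : ℂ) : Prop :=
  ∀ n : ℕ, Complex.cos ((tanFamily lam)^[n] z) ≠ 0

/-- `z` is a periodic point of `f_λ` of exact period `p ≥ 1` whose multiplier `(f_λ^p)'(z)` has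
modulus less than one. -/
def IsAttractingPeriodicPoint (lam : ℂ) (p : ℕ) (z : ℂ) : Prop :=
  0 < p ∧ OrbitDefined lam z ∧ Function.minimalPeriod (tanFamily lam) z = p ∧
    ‖deriv ((tanFamily lam)^[p]) z‖ < 1

/-- The set of attracting fixed points of `f_λ`. -/
def attractingFixedPoints (lam : ℂ) : Set ℂ := {z | IsAttractingPeriodicPoint lam 1 z}

/-- `C` is an attracting cycle of `f_λ` of exact period `p`, as a set of points. -/
def IsAttractingCycle (lam : ℂ) (p : ℕ) (C : Set ℂ) : Prop :=
  ∃ z : ℂ, IsAttractingPeriodicPoint lam p z ∧ C = Set.range fun n : ℕ => (tanFamily lam)^[n] z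

/-- `v` is an asymptotic value of `f_λ`: the limit of `f_λ` along a path that tends to infinity. -/
def IsAsymptoticValue (lam v : ℂ) : Prop :=
  ∃ α : ℝ → ℂ, ContinuousOn α (Set.Ici 0) ∧ Tendsto (fun t => ‖α t‖) atTop atTop ∧
    (∀ᶠ t in atTop, Complex.cos (α t) ≠ 0) ∧
    Tendsto (fun t => tanFamily lam (α t)) atTop (𝓝 v)

/-- The cycle `C` attracts the point `v`: the forward orbit of `v` is defined and converges
to `C`. -/
def IsAttractedTo (lam v : ℂ) (C : Set ℂ) : Prop :=
  OrbitDefined lam v ∧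
    Tendsto (fun n : ℕ => Metric.infDist ((tanFamily lam)^[n] v) C) atTop (𝓝 0)

/-- The hyperbolic parameters: the nonzero `λ` for which `f_λ` has an attracting periodic cycle. -/
def hyperbolicParameters : Set ℂ :=
  {lam | lam ≠ 0 ∧ ∃ (p : ℕ) (z : ℂ), IsAttractingPeriodicPoint lam p z}

/-- A hyperbolic component: a connected component of the set of hyperbolic parameters. -/
def IsHyperbolicComponent (Ω : Set ℂ) : Prop :=
  ∃ lam ∈ hyperbolicParameters, Ω = connectedComponentIn hyperbolicParameters lam

/-- Along the filter `F` of parameters, the real part `t` of the curve `γ` tends to the end `R` of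
the real line, and `γ` follows the curve `t + i ε e^{|2t|}` (with `ε = 1` or `ε = -1`): the
imaginary part of `γ` has the sign of `ε` and its modulus is of exact order `e^{|2t|}`. -/
def FollowsExpCurve (γ : ℝ → ℂ) (F R : Filter ℝ) (ε : ℝ) : Prop :=
  Tendsto (fun s => (γ s).re) F R ∧
    ∃ c C : ℝ, 0 < c ∧ 0 < C ∧ ∀ᶠ s in F,
      c * Real.exp |2 * (γ s).re| ≤ ε * (γ s).im ∧ ε * (γ s).im ≤ C * Real.exp |2 * (γ s).re|

/-- The boundary of `Ω` is a curve, one end of which follows `t + i e^{|2t|}` and the other end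
`t - i e^{|2t|}`, as the real part `t` tends to the end `R` of the real line. -/
def BoundaryFollowsExpCurves (Ω : Set ℂ) (R : Filter ℝ) : Prop :=
  ∃ γ : ℝ → ℂ, Continuous γ ∧ Set.range γ = frontier Ω ∧
    FollowsExpCurve γ atTop R 1 ∧ FollowsExpCurve γ atBot R (-1)

/-! Ω₁ is the set `nonzeroFixedParameters` of parameters with a nonzero attracting fixed point, and
Ω₂ is its negative: since f_{-λ}^n = (-1)^n f_λ^n, a fixed point z ≠ 0 of f_λ spans the 2-cycle {z,
-z} of f_{-λ}.

Dynamics. An attracting cycle attracts one of the asymptotic values ±λi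
(`exists_asymptoticValue_attracted`): otherwise inverse branches of all iterates would exist on a
fixed disc, with unbounded derivatives at a point of the cycle. The basin is only required to omit a
disc, which a second attracting cycle supplies. By oddness an attracting fixed point z ≠ 0 comes
with -z, and the pair uses up both asymptotic values, so there is no other attracting cycle.
Together with persistence under perturbation this makes the set open and relatively closed among
hyperbolic parameters (`closure_nonzeroFixedParameters_inter`), hence a component once it is
connected.

Geometry. A point z ≠ 0 is fixed exactly when λ = z cot z, and its multiplier is then 2z / sin 2z.
With w = 2z the set is the image of {|w| < |sin w|}, whose upper half lies above a graph and is
connected. The boundary is the image of |w| = |sin w|. There |x| is comparable to e^y, while (w/2)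
cot(w/2) = -iw/2 + O(1), so Re λ ≈ y/2 and |Im λ| ≈ |x|/2 has order e^{2 Re λ}. -/

/-! ### Symmetries and regularity of the iterates -/

theorem tanFamily_neg (lam z : ℂ) : tanFamily lam (-z) = -tanFamily lam z := by
  simp [tanFamily]

theorem tanFamily_iterate_neg (lam z : ℂ) (n : ℕ) :
    (tanFamily lam)^[n] (-z) = -(tanFamily lam)^[n] z := by
  induction n with
  | zero => simp
  | succ n ih => rw [Function.iterate_succ_apply', ih, tanFamily_neg, Function.iterate_succ_apply']

theorem tanFamily_neg_param_iterate (lam z : ℂ) (n : ℕ) :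
    (tanFamily (-lam))^[n] z = (-1) ^ n * (tanFamily lam)^[n] z := by
  induction n with
  | zero => simp
  | succ n ih =>
    rw [Function.iterate_succ_apply', ih, Function.iterate_succ_apply', pow_succ]
    rcases neg_one_pow_eq_or ℂ n with h | h <;> simp [h, tanFamily]

theorem OrbitDefined.neg {lam z : ℂ} (h : OrbitDefined lam z) : OrbitDefined lam (-z) := by
  intro n
  rw [tanFamily_iterate_neg, Complex.cos_neg]
  exact h n

theorem OrbitDefined.neg_param {lam z : ℂ} (h : OrbitDefined lam z) :
    OrbitDefined (-lam) z := by
  intro n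
  rw [tanFamily_neg_param_iterate]
  rcases neg_one_pow_eq_or ℂ n with h' | h' <;> simp [h', h n]

theorem tanFamily_neg_param_iterate_two_mul (lam : ℂ) (n : ℕ) :
    (tanFamily (-lam))^[2 * n] = (tanFamily lam)^[2 * n] := by
  funext z
  simp [tanFamily_neg_param_iterate]

theorem OrbitDefined.of_iterate {lam z : ℂ} {m : ℕ} (h : OrbitDefined lam ((tanFamily lam)^[m] z))
    (h' : ∀ k < m, Complex.cos ((tanFamily lam)^[k] z) ≠ 0) : OrbitDefined lam z := by
  intro n
  rcases lt_or_ge n m with hn | hn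
  · exact h' n hn
  · have := h (n - m)
    rwa [← Function.iterate_add_apply, Nat.sub_add_cancel hn] at this

/-- The iterates are jointly continuously differentiable in the parameter and the variable. -/
theorem contDiffAt_tanFamily_iterate {lam z : ℂ} {n : ℕ}
    (h : ∀ k < n, Complex.cos ((tanFamily lam)^[k] z) ≠ 0) :
    ContDiffAt ℂ 1 (fun x : ℂ × ℂ => (tanFamily x.1)^[n] x.2) (lam, z) := by
  induction n with
  | zero => simpa using contDiffAt_snd
  | succ n ih =>
    simp only [Function.iterate_succ_apply']
    have h1 := ih fun k hk => h k (by omega)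
    have h2 : ContDiffAt ℂ 1 Complex.tan ((tanFamily lam)^[n] z) :=
      Complex.contDiffAt_tan.2 (h n (by omega))
    exact contDiffAt_fst.mul
      (ContDiffAt.comp (lam, z) (g := Complex.tan)
        (f := fun x : ℂ × ℂ => (tanFamily x.1)^[n] x.2) h2 h1)

theorem differentiableAt_tanFamily_iterate {lam z : ℂ} {n : ℕ}
    (h : ∀ k < n, Complex.cos ((tanFamily lam)^[k] z) ≠ 0) :
    DifferentiableAt ℂ ((tanFamily lam)^[n]) z := by
  have h1 := (contDiffAt_tanFamily_iterate h).differentiableAt one_ne_zero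
  have h2 : DifferentiableAt ℂ (fun w : ℂ => (lam, w)) z := by fun_prop
  exact DifferentiableAt.comp z (g := fun x : ℂ × ℂ => (tanFamily x.1)^[n] x.2) h1 h2

theorem OrbitDefined.differentiableAt {lam z : ℂ} (h : OrbitDefined lam z) (n : ℕ) :
    DifferentiableAt ℂ ((tanFamily lam)^[n]) z :=
  differentiableAt_tanFamily_iterate fun k _ => h k

/-! ### Attracting periodic points and their basins -/

/-- A point fixed by an iterate with multiplier of modulus less than one is attracting
periodic. -/
theorem isAttractingPeriodicPoint_minimalPeriod {lam z : ℂ} {p : ℕ} (hp : 0 < p)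
    (h : OrbitDefined lam z) (hz : (tanFamily lam)^[p] z = z)
    (hd : ‖deriv ((tanFamily lam)^[p]) z‖ < 1) :
    IsAttractingPeriodicPoint lam (Function.minimalPeriod (tanFamily lam) z) z := by
  have hper : Function.IsPeriodicPt (tanFamily lam) p z := hz
  refine ⟨hper.minimalPeriod_pos hp, h, rfl, ?_⟩
  obtain ⟨m, hm⟩ := hper.minimalPeriod_dvd
  set q := Function.minimalPeriod (tanFamily lam) z
  have hq : (tanFamily lam)^[q] z = z := Function.isPeriodicPt_minimalPeriod _ _
  have hd' := HasDerivAt.iterate _ (h.differentiableAt q).hasDerivAt hq m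
  rw [← Function.iterate_mul, ← hm] at hd'
  rw [hd'.deriv, norm_pow] at hd
  by_contra hcon
  exact absurd hd (not_lt.2 (one_le_pow₀ (not_lt.1 hcon)))

theorem IsAttractingPeriodicPoint.iterate_eq {lam z : ℂ} {p : ℕ}
    (h : IsAttractingPeriodicPoint lam p z) : (tanFamily lam)^[p] z = z := by
  have := Function.isPeriodicPt_minimalPeriod (tanFamily lam) z
  rw [h.2.2.1] at this
  exact this

theorem IsAttractingPeriodicPoint.iterate_mul_eq {lam z : ℂ} {p : ℕ}
    (h : IsAttractingPeriodicPoint lam p z) (m : ℕ) : (tanFamily lam)^[p * m] z = z :=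
  Function.IsPeriodicPt.mul_const (f := tanFamily lam) h.iterate_eq m

theorem IsAttractingPeriodicPoint.neg {lam z : ℂ} {p : ℕ}
    (h : IsAttractingPeriodicPoint lam p z) : IsAttractingPeriodicPoint lam p (-z) := by
  have h1 : (tanFamily lam)^[p] = fun w => -(tanFamily lam)^[p] (-w) := by
    funext w; rw [tanFamily_iterate_neg, neg_neg]
  refine ⟨h.1, h.2.1.neg, ?_, ?_⟩
  · rw [← h.2.2.1]
    refine Function.minimalPeriod_eq_minimalPeriod_iff.2 fun n => ?_
    simp only [Function.IsPeriodicPt, Function.IsFixedPt, tanFamily_iterate_neg, neg_inj]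
  · have h2 := h.2.2.2
    rw [h1, deriv.fun_neg, deriv_comp_neg, neg_neg, neg_neg]
    exact h2

/-- Attracting periodic points of `f_λ` are attracting periodic points of `f_{-λ}`. -/
theorem IsAttractingPeriodicPoint.neg_param {lam z : ℂ} {p : ℕ}
    (h : IsAttractingPeriodicPoint lam p z) :
    ∃ q, IsAttractingPeriodicPoint (-lam) q z := by
  -- Even iterates of f_λ and f_{-λ} agree, so 2p is a period for both; the exact period may differ
  -- from p.
  have hz : (tanFamily lam)^[2 * p] z = z := by rw [mul_comm]; exact h.iterate_mul_eq 2
  refine ⟨_, isAttractingPeriodicPoint_minimalPeriod (p := 2 * p) (by have := h.1; omega)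
    h.2.1.neg_param (by rw [tanFamily_neg_param_iterate_two_mul, hz]) ?_⟩
  rw [tanFamily_neg_param_iterate_two_mul, mul_comm, Function.iterate_mul]
  rw [(HasDerivAt.iterate _ (h.2.1.differentiableAt p).hasDerivAt h.iterate_eq 2).deriv, norm_pow]
  exact pow_lt_one₀ (norm_nonneg _) h.2.2.2 two_ne_zero

/-- Near an attracting periodic point all orbits are asymptotic to its orbit. -/
theorem IsAttractingPeriodicPoint.exists_ball {lam z : ℂ} {p : ℕ}
    (h : IsAttractingPeriodicPoint lam p z) :
    ∃ r > 0, ∀ w ∈ Metric.ball z r, OrbitDefined lam w ∧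
      Tendsto (fun n => dist ((tanFamily lam)^[n] w) ((tanFamily lam)^[n] z)) atTop (𝓝 0) := by
  obtain ⟨hp, hO, -, hd⟩ := id h
  obtain ⟨c, hc1, hc2⟩ := exists_between hd
  have hc0 : 0 < c := (norm_nonneg _).trans_lt hc1
  set g := (tanFamily lam)^[p] with hg
  have hgz : g z = z := h.iterate_eq
  have e1 : ∀ᶠ w in 𝓝 z, ‖g w - z‖ ≤ c * ‖w - z‖ := by
    have h1 := (hO.differentiableAt p).hasDerivAt.hasFDerivAt.isLittleO
    have h2 := h1.def (sub_pos.2 hc1)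
    filter_upwards [h2] with w hw
    have h3 : g w - z = (g w - g z - (w - z) * deriv g z) + (w - z) * deriv g z := by
      rw [hgz]; ring
    rw [h3]
    refine (norm_add_le _ _).trans ?_
    rw [norm_mul]
    have hw' : ‖g w - g z - (w - z) * deriv g z‖ ≤ (c - ‖deriv g z‖) * ‖w - z‖ := by
      simpa using hw
    linarith
  have e2 : ∀ᶠ w in 𝓝 z, ∀ k < p, Complex.cos ((tanFamily lam)^[k] w) ≠ 0 := by
    have : ∀ k ∈ Finset.range p, ∀ᶠ w in 𝓝 z, Complex.cos ((tanFamily lam)^[k] w) ≠ 0 := by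
      intro k _
      have hk : ContinuousAt (fun w => Complex.cos ((tanFamily lam)^[k] w)) z :=
        Complex.continuous_cos.continuousAt.comp (hO.differentiableAt k).continuousAt
      exact hk.eventually_ne (hO k)
    have := (Finset.eventually_all (Finset.range p)).2 this
    simpa using this
  obtain ⟨r, hr, hr'⟩ := Metric.eventually_nhds_iff_ball.1 (e1.and e2)
  refine ⟨r, hr, fun w hw => ?_⟩
  have key : ∀ m, g^[m] w ∈ Metric.ball z r ∧ ‖g^[m] w - z‖ ≤ c ^ m * ‖w - z‖ := by
    intro m
    induction m with
    | zero => simpa using hw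
    | succ m ih =>
      have h1 := (hr' _ ih.1).1
      rw [Function.iterate_succ_apply']
      refine ⟨?_, ?_⟩
      · have h2 := mem_ball_iff_norm.1 ih.1
        rw [mem_ball_iff_norm]
        nlinarith [norm_nonneg (g^[m] w - z)]
      · calc _ ≤ _ := h1
          _ ≤ c * (c ^ m * ‖w - z‖) := by gcongr; exact ih.2
          _ = _ := by ring
  have split : ∀ n x, (tanFamily lam)^[n] x = (tanFamily lam)^[n % p] (g^[n / p] x) := by
    intro n x
    rw [hg, ← Function.iterate_mul, ← Function.iterate_add_apply, Nat.mod_add_div]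
  refine ⟨fun n => ?_, ?_⟩
  · rw [split]
    exact (hr' _ (key _).1).2 _ (Nat.mod_lt _ hp)
  · have hlim : Tendsto (fun m => g^[m] w) atTop (𝓝 z) := by
      rw [tendsto_iff_norm_sub_tendsto_zero]
      refine squeeze_zero (fun _ => norm_nonneg _) (fun m => (key m).2) ?_
      simpa using (tendsto_pow_atTop_nhds_zero_of_lt_one hc0.le hc2).mul_const ‖w - z‖
    have hdiv : Tendsto (fun n => g^[n / p] w) atTop (𝓝 z) :=
      hlim.comp (Nat.tendsto_div_const_atTop hp.ne')
    rw [Metric.tendsto_nhds]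
    intro ε hε
    have : ∀ k ∈ Finset.range p, ∀ᶠ x in 𝓝 z,
        dist ((tanFamily lam)^[k] x) ((tanFamily lam)^[k] z) < ε := fun k _ =>
      Metric.continuousAt_iff'.1 (hO.differentiableAt k).continuousAt ε hε
    have := hdiv.eventually ((Finset.eventually_all (Finset.range p)).2 this)
    filter_upwards [this] with n hn
    rw [Real.dist_0_eq_abs, abs_of_nonneg dist_nonneg, split n w, split n z,
      Function.iterate_fixed hgz]
    exact hn _ (Finset.mem_range.2 (Nat.mod_lt _ hp))

/-- The forward orbit of a point as a set. -/
abbrev forwardOrbit (lam z : ℂ) : Set ℂ := Set.range fun n : ℕ => (tanFamily lam)^[n] z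

theorem IsAttractedTo.of_iterate {lam v : ℂ} {C : Set ℂ} {m : ℕ}
    (h : IsAttractedTo lam ((tanFamily lam)^[m] v) C)
    (h' : ∀ k < m, Complex.cos ((tanFamily lam)^[k] v) ≠ 0) : IsAttractedTo lam v C := by
  refine ⟨h.1.of_iterate h', ?_⟩
  have := h.2
  simp only [← Function.iterate_add_apply] at this
  exact (tendsto_add_atTop_iff_nat (f := fun n => Metric.infDist ((tanFamily lam)^[n] v) C) m).1 this

theorem IsAttractingPeriodicPoint.exists_ball_attracted {lam z : ℂ} {p : ℕ}
    (h : IsAttractingPeriodicPoint lam p z) :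
    ∃ r > 0, ∀ w ∈ Metric.ball z r, IsAttractedTo lam w (forwardOrbit lam z) := by
  obtain ⟨r, hr, H⟩ := h.exists_ball
  refine ⟨r, hr, fun w hw => ⟨(H w hw).1, ?_⟩⟩
  exact squeeze_zero (fun _ => Metric.infDist_nonneg)
    (fun n => Metric.infDist_le_dist_of_mem ⟨n, rfl⟩) (H w hw).2

theorem IsAttractingPeriodicPoint.finite_forwardOrbit {lam z : ℂ} {p : ℕ}
    (h : IsAttractingPeriodicPoint lam p z) : (forwardOrbit lam z).Finite := by
  refine ((Set.finite_lt_nat p).image fun n => (tanFamily lam)^[n] z).subset ?_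
  rintro _ ⟨n, rfl⟩
  refine ⟨n % p, Nat.mod_lt _ h.1, ?_⟩
  exact Function.IsPeriodicPt.iterate_mod_apply (f := tanFamily lam) h.iterate_eq n

/-- Two attracting cycles that attract the same point coincide. -/
theorem mem_forwardOrbit_of_isAttractedTo {lam z z' v : ℂ} {p p' : ℕ}
    (h : IsAttractingPeriodicPoint lam p z) (h' : IsAttractingPeriodicPoint lam p' z')
    (hv : IsAttractedTo lam v (forwardOrbit lam z))
    (hv' : IsAttractedTo lam v (forwardOrbit lam z')) : z' ∈ forwardOrbit lam z := by
  have hmeet : ¬ Disjoint (forwardOrbit lam z) (forwardOrbit lam z') := by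
    intro hd
    obtain ⟨δ, hδ, hδ'⟩ := hd.exists_thickenings h.finite_forwardOrbit.isCompact
      h'.finite_forwardOrbit.isClosed
    have e1 := hv.2.eventually (gt_mem_nhds hδ)
    have e2 := hv'.2.eventually (gt_mem_nhds hδ)
    obtain ⟨n, hn1, hn2⟩ := (e1.and e2).exists
    exact Set.disjoint_left.1 hδ'
      ((Metric.mem_thickening_iff_infDist_lt (Set.range_nonempty _)).2 hn1)
      ((Metric.mem_thickening_iff_infDist_lt (Set.range_nonempty _)).2 hn2)
  obtain ⟨_, ⟨a, rfl⟩, ⟨b, hb⟩⟩ := Set.not_disjoint_iff.1 hmeet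
  -- From the common point, b steps past z', the orbit returns to z' by completing a multiple of p'
  -- that is at least b.
  have hle : b ≤ p' * (b + 1) := by nlinarith [h'.1]
  have h1 := h'.iterate_mul_eq (b + 1)
  refine ⟨p' * (b + 1) - b + a, ?_⟩
  simp only at hb ⊢
  rw [Function.iterate_add_apply, ← hb, ← Function.iterate_add_apply, Nat.sub_add_cancel hle, h1]

theorem IsAttractedTo.neg {lam v : ℂ} {C : Set ℂ} (h : IsAttractedTo lam v C) :
    IsAttractedTo lam (-v) (-C) := by
  refine ⟨h.1.neg, ?_⟩
  convert h.2 using 2 with n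
  rw [tanFamily_iterate_neg]
  have := Metric.infDist_image (IsometryEquiv.neg ℂ).isometry (x := (tanFamily lam)^[n] v) (t := C)
  simpa using this

theorem forwardOrbit_neg (lam z : ℂ) : forwardOrbit lam (-z) = -forwardOrbit lam z := by
  ext w
  simp only [forwardOrbit, Set.mem_range, Set.mem_neg, tanFamily_iterate_neg, neg_eq_iff_eq_neg]

/-! ### Inverse branches and Fatou's theorem -/

/-- The relation e^{2iy} = (1 + iu)/(1 - iu) for u = tan y, cleared of denominators so that no pole
or value u = ±i has to be excluded. -/
theorem exp_mul_eq_iff (y u : ℂ) :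
    Complex.exp (2 * Complex.I * y) * (1 - Complex.I * u) = 1 + Complex.I * u ↔
      Complex.sin y = u * Complex.cos y := by
  have h1 : Complex.exp (2 * Complex.I * y) =
      (Complex.cos y + Complex.sin y * Complex.I) ^ 2 := by
    rw [← Complex.exp_mul_I, ← Complex.exp_nat_mul]; congr 1; push_cast; ring
  have h2 := Complex.sin_sq_add_cos_sq y
  have hI := Complex.I_sq
  have hne : Complex.cos y + Complex.sin y * Complex.I ≠ 0 := by
    rw [← Complex.exp_mul_I]; exact Complex.exp_ne_zero _
  have hinv : (Complex.cos y + Complex.sin y * Complex.I) *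
      (Complex.cos y - Complex.sin y * Complex.I) = 1 := by
    linear_combination h2 - Complex.sin y ^ 2 * hI
  rw [h1]
  constructor
  · intro h
    have h3 : (Complex.cos y + Complex.sin y * Complex.I) *
        (2 * Complex.I * (Complex.sin y - u * Complex.cos y)) = 0 := by
      linear_combination h - (1 + Complex.I * u) * hinv
    have h4 := (mul_eq_zero.1 h3).resolve_left hne
    have h5 := (mul_eq_zero.1 h4).resolve_left (by simp)
    exact sub_eq_zero.1 h5
  · intro h
    linear_combination (1 + Complex.I * u) * hinv +
      (Complex.cos y + Complex.sin y * Complex.I) * 2 * Complex.I * h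

theorem tan_eq_of_exp {y u : ℂ}
    (h : Complex.exp (2 * Complex.I * y) * (1 - Complex.I * u) = 1 + Complex.I * u) :
    Complex.cos y ≠ 0 ∧ Complex.tan y = u := by
  have h1 := (exp_mul_eq_iff y u).1 h
  have h2 : Complex.cos y ≠ 0 := by
    intro h0
    have h3 := Complex.sin_sq_add_cos_sq y
    rw [h1, h0] at h3
    simp at h3
  exact ⟨h2, by rw [Complex.tan_eq_sin_div_cos, h1, mul_div_cancel_right₀ _ h2]⟩

/-- A nonvanishing holomorphic function on a disc has a holomorphic logarithm with prescribed
value at the centre. -/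
theorem exists_log_on_ball {q : ℂ → ℂ} {z a : ℂ} {r : ℝ} (hr : 0 < r)
    (hq : DifferentiableOn ℂ q (Metric.ball z r)) (h0 : ∀ w ∈ Metric.ball z r, q w ≠ 0)
    (ha : Complex.exp a = q z) :
    ∃ L : ℂ → ℂ, DifferentiableOn ℂ L (Metric.ball z r) ∧ L z = a ∧
      ∀ w ∈ Metric.ball z r, Complex.exp (L w) = q w := by
  have hd : DifferentiableOn ℂ (fun w => deriv q w / q w) (Metric.ball z r) :=
    (hq.deriv Metric.isOpen_ball).div hq h0
  obtain ⟨L, hL, hL'⟩ := hd.isExactOn_ball.with_val_at z a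
  have hLd : DifferentiableOn ℂ L (Metric.ball z r) := fun w hw =>
    (hL' w hw).differentiableAt.differentiableWithinAt
  refine ⟨L, hLd, hL, ?_⟩
  have hder : ∀ w ∈ Metric.ball z r,
      HasDerivAt (fun w => Complex.exp (-L w) * q w) 0 w := by
    intro w hw
    have h1 := (hL' w hw).neg.cexp
    have h2 := (hq.differentiableAt (Metric.isOpen_ball.mem_nhds hw)).hasDerivAt
    refine (h1.mul h2).congr_deriv ?_
    have := h0 w hw
    field_simp
    ring
  intro w hw
  have h1 := (convex_ball z r).is_const_of_fderivWithin_eq_zero (𝕜 := ℂ)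
    (f := fun w => Complex.exp (-L w) * q w)
    (fun w hw => (hder w hw).differentiableAt.differentiableWithinAt)
    (fun w hw => by
      rw [fderivWithin_of_isOpen Metric.isOpen_ball hw]
      have := (hder w hw).hasFDerivAt.fderiv
      simpa using this) hw (Metric.mem_ball_self hr)
  simp only [hL] at h1
  rw [← ha, ← Complex.exp_add, neg_add_cancel, Complex.exp_zero, Complex.exp_neg] at h1
  field_simp at h1
  exact h1.symm

/-- Holomorphic inverse branches of `f_λ` along a map of a disc that omits the asymptotic
values. -/
theorem exists_inverse_branch {lam z y : ℂ} {r : ℝ} (hr : 0 < r) (hlam : lam ≠ 0) {h : ℂ → ℂ}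
    (hd : DifferentiableOn ℂ h (Metric.ball z r))
    (h1 : ∀ w ∈ Metric.ball z r, h w ≠ lam * Complex.I)
    (h2 : ∀ w ∈ Metric.ball z r, h w ≠ -(lam * Complex.I))
    (hy : Complex.cos y ≠ 0) (hy' : tanFamily lam y = h z) :
    ∃ g : ℂ → ℂ, DifferentiableOn ℂ g (Metric.ball z r) ∧ g z = y ∧
      ∀ w ∈ Metric.ball z r, Complex.cos (g w) ≠ 0 ∧ tanFamily lam (g w) = h w := by
  have hI := Complex.I_sq
  have hnum : ∀ w ∈ Metric.ball z r, 1 + Complex.I * (h w / lam) ≠ 0 := by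
    intro w hw h0
    apply h1 w hw
    field_simp at h0
    linear_combination -Complex.I * h0 + h w * hI
  have hden : ∀ w ∈ Metric.ball z r, 1 - Complex.I * (h w / lam) ≠ 0 := by
    intro w hw h0
    apply h2 w hw
    field_simp at h0
    linear_combination Complex.I * h0 + h w * hI
  -- The quotient is e^{2iy} for tan y = h/λ; its zero and its pole are the two omitted asymptotic
  -- values, so it has a logarithm.
  obtain ⟨L, hL, hLz, hLe⟩ := exists_log_on_ball
    (q := fun w => (1 + Complex.I * (h w / lam)) / (1 - Complex.I * (h w / lam)))
    (a := 2 * Complex.I * y) hr (by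
      refine DifferentiableOn.div ?_ ?_ hden <;> fun_prop)
    (fun w hw => div_ne_zero (hnum w hw) (hden w hw)) (by
      rw [eq_div_iff (hden z (Metric.mem_ball_self hr)), exp_mul_eq_iff, ← hy', tanFamily,
        mul_div_cancel_left₀ _ hlam, Complex.tan_mul_cos hy])
  refine ⟨fun w => L w / (2 * Complex.I), hL.div_const _, by
    simp only [hLz]; field_simp, fun w hw => ?_⟩
  have h3 : Complex.exp (2 * Complex.I * (L w / (2 * Complex.I))) *
      (1 - Complex.I * (h w / lam)) = 1 + Complex.I * (h w / lam) := by
    rw [mul_div_cancel₀ _ (by simp), hLe w hw, div_mul_cancel₀ _ (hden w hw)]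
  obtain ⟨h4, h5⟩ := tan_eq_of_exp h3
  exact ⟨h4, by rw [tanFamily, h5, mul_div_cancel₀ _ hlam]⟩

/-- If no asymptotic value is attracted to the cycle of `z`, all inverse branches along the cycle
are defined on a fixed disc. -/
theorem exists_iterated_inverse_branch {lam z : ℂ} {p : ℕ} (hlam : lam ≠ 0)
    (hz : IsAttractingPeriodicPoint lam p z) {r : ℝ} (hr : 0 < r)
    (hball : ∀ w ∈ Metric.ball z r, IsAttractedTo lam w (forwardOrbit lam z))
    (h1 : ¬ IsAttractedTo lam (lam * Complex.I) (forwardOrbit lam z))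
    (h2 : ¬ IsAttractedTo lam (-(lam * Complex.I)) (forwardOrbit lam z)) (n : ℕ) :
    ∃ h : ℂ → ℂ, DifferentiableOn ℂ h (Metric.ball z r) ∧
      h z = (tanFamily lam)^[(p - 1) * n] z ∧
      ∀ w ∈ Metric.ball z r, (tanFamily lam)^[n] (h w) = w ∧
        ∀ k < n, Complex.cos ((tanFamily lam)^[k] (h w)) ≠ 0 := by
  induction n with
  | zero => exact ⟨id, differentiableOn_id, by simp, by simp⟩
  | succ n ih =>
    obtain ⟨h, hd, hhz, hh⟩ := ih
    -- The branch takes values in the basin, which contains neither asymptotic value, so it can be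
    -- pulled back once more.
    have hatt : ∀ w ∈ Metric.ball z r, IsAttractedTo lam (h w) (forwardOrbit lam z) := by
      intro w hw
      exact IsAttractedTo.of_iterate (m := n) (by rw [(hh w hw).1]; exact hball w hw) (hh w hw).2
    obtain ⟨g, hg, hgz, hgw⟩ := exists_inverse_branch
      -- On the cycle, one step backward is p - 1 steps forward.
      (y := (tanFamily lam)^[(p - 1) * (n + 1)] z) hr hlam hd
      (fun w hw h0 => h1 (h0 ▸ hatt w hw)) (fun w hw h0 => h2 (h0 ▸ hatt w hw)) (hz.2.1 _) (by
        rw [hhz, ← Function.iterate_succ_apply' (f := tanFamily lam)]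
        have hp := hz.1
        have : ((p - 1) * (n + 1)).succ = (p - 1) * n + p := by
          rw [Nat.succ_eq_add_one, mul_add]; omega
        rw [this, Function.iterate_add_apply, hz.iterate_eq])
    refine ⟨g, hg, hgz, fun w hw => ⟨?_, ?_⟩⟩
    · rw [Function.iterate_succ_apply, (hgw w hw).2, (hh w hw).1]
    · intro k hk
      cases k with
      | zero => exact (hgw w hw).1
      | succ k =>
        rw [Function.iterate_succ_apply, (hgw w hw).2]
        exact (hh w hw).2 k (by omega)

/-- A bound for the derivative of a holomorphic map of a disc that omits a disc. -/
theorem norm_deriv_le_of_omits_ball {h : ℂ → ℂ} {z b : ℂ} {r ε : ℝ} (hr : 0 < r) (hε : 0 < ε)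
    (hd : DifferentiableOn ℂ h (Metric.ball z r))
    (hb : ∀ w ∈ Metric.ball z r, h w ∉ Metric.ball b ε) :
    ‖deriv h z‖ ≤ ε⁻¹ / (r / 2) * ‖h z - b‖ ^ 2 := by
  have hge : ∀ w ∈ Metric.ball z r, ε ≤ ‖h w - b‖ := fun w hw => by
    simpa [dist_eq_norm] using hb w hw
  have hne : ∀ w ∈ Metric.ball z r, h w - b ≠ 0 := fun w hw =>
    norm_pos_iff.1 (hε.trans_le (hge w hw))
  have hsub : Metric.closedBall z (r / 2) ⊆ Metric.ball z r :=
    Metric.closedBall_subset_ball (by linarith)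
  have hzm : z ∈ Metric.ball z r := Metric.mem_ball_self hr
  -- Inversion at b turns the omitted disc into the bound 1/ε, to which Cauchy's estimate applies.
  have h1 : ‖deriv (fun w => (h w - b)⁻¹) z‖ ≤ ε⁻¹ / (r / 2) := by
    refine Complex.norm_deriv_le_of_forall_mem_sphere_norm_le (by linarith) ?_ ?_
    · refine DifferentiableOn.diffContOnCl ?_
      rw [closure_ball _ (by linarith)]
      exact ((hd.sub_const b).inv hne).mono hsub
    · intro w hw
      rw [norm_inv]
      exact inv_anti₀ hε (hge w (hsub (Metric.sphere_subset_closedBall hw)))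
  have h2 : HasDerivAt (fun w => (h w - b)⁻¹) (-deriv h z / (h z - b) ^ 2) z :=
    ((hd.differentiableAt (Metric.isOpen_ball.mem_nhds hzm)).hasDerivAt.sub_const b).inv
      (hne z hzm)
  rw [h2.deriv, norm_div, norm_neg, norm_pow] at h1
  rwa [div_le_iff₀ (pow_pos (norm_pos_iff.2 (hne z hzm)) 2)] at h1

/-- **Fatou's theorem** for the tangent family, in the case where the basin omits a disc: an
attracting cycle attracts an asymptotic value. -/
theorem exists_asymptoticValue_attracted {lam z b : ℂ} {p : ℕ} {ε : ℝ} (hlam : lam ≠ 0)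
    (hz : IsAttractingPeriodicPoint lam p z) (hε : 0 < ε)
    (hb : ∀ w ∈ Metric.ball b ε, ¬ IsAttractedTo lam w (forwardOrbit lam z)) :
    IsAttractedTo lam (lam * Complex.I) (forwardOrbit lam z) ∨
      IsAttractedTo lam (-(lam * Complex.I)) (forwardOrbit lam z) := by
  by_contra! hcon
  obtain ⟨r, hr, hball⟩ := hz.exists_ball_attracted
  have hzm : z ∈ Metric.ball z r := Metric.mem_ball_self hr
  set μ := deriv ((tanFamily lam)^[p]) z
  set M := ε⁻¹ / (r / 2) * ‖z - b‖ ^ 2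
  -- The branch inverse to f^{pm} that fixes z has derivative μ^{-m} there, bounded by M uniformly
  -- in m; this contradicts μ^m → 0.
  have key : ∀ m : ℕ, 1 ≤ ‖μ‖ ^ m * M := by
    intro m
    obtain ⟨h, hd, hhz, hh⟩ :=
      exists_iterated_inverse_branch hlam hz hr hball hcon.1 hcon.2 (p * m)
    have hhz' : h z = z := by
      rw [hhz, show (p - 1) * (p * m) = p * ((p - 1) * m) by ring]
      exact hz.iterate_mul_eq _
    have hM := norm_deriv_le_of_omits_ball hr hε hd fun w hw hw' =>
      hb _ hw' (IsAttractedTo.of_iterate (m := p * m)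
        (by rw [(hh w hw).1]; exact hball w hw) (hh w hw).2)
    rw [hhz'] at hM
    have hf : HasDerivAt ((tanFamily lam)^[p * m]) (μ ^ m) z := by
      rw [Function.iterate_mul]
      exact HasDerivAt.iterate _ (hz.2.1.differentiableAt p).hasDerivAt hz.iterate_eq m
    have hhd := (hd.differentiableAt (Metric.isOpen_ball.mem_nhds hzm)).hasDerivAt
    rw [← hhz'] at hf
    have hcomp := HasDerivAt.comp z hf hhd
    have hid : HasDerivAt ((tanFamily lam)^[p * m] ∘ h) 1 z := by
      refine (hasDerivAt_id z).congr_of_eventuallyEq ?_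
      filter_upwards [Metric.isOpen_ball.mem_nhds hzm] with w hw
      exact (hh w hw).1
    have heq := congrArg norm (hcomp.unique hid)
    rw [norm_mul, norm_pow, norm_one] at heq
    rw [← heq]
    gcongr
  have hlim : Tendsto (fun m : ℕ => ‖μ‖ ^ m * M) atTop (𝓝 (0 * M)) :=
    (tendsto_pow_atTop_nhds_zero_of_lt_one (norm_nonneg _) hz.2.2.2).mul_const M
  have := ge_of_tendsto' hlim key
  norm_num at this

/-! ### Nonzero attracting fixed points -/

theorem isAttractingPeriodicPoint_one_iff {lam z : ℂ} :
    IsAttractingPeriodicPoint lam 1 z ↔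
      Complex.cos z ≠ 0 ∧ tanFamily lam z = z ∧ ‖lam / Complex.cos z ^ 2‖ < 1 := by
  have hder : Complex.cos z ≠ 0 →
      deriv ((tanFamily lam)^[1]) z = lam / Complex.cos z ^ 2 := by
    intro hc
    rw [Function.iterate_one]
    have := (Complex.hasDerivAt_tan hc).const_mul lam
    rw [mul_one_div] at this
    exact this.deriv
  constructor
  · intro h
    have hc : Complex.cos z ≠ 0 := h.2.1 0
    refine ⟨hc, h.iterate_eq, ?_⟩
    rw [← hder hc]
    exact h.2.2.2
  · rintro ⟨hc, hf, hd⟩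
    refine ⟨one_pos, fun n => ?_, Function.minimalPeriod_eq_one_iff_isFixedPt.2 hf, ?_⟩
    · rwa [Function.iterate_fixed hf]
    · rwa [hder hc]

theorem forwardOrbit_of_fixed {lam z : ℂ} (h : tanFamily lam z = z) : forwardOrbit lam z = {z} := by
  ext w
  simp [forwardOrbit, Function.iterate_fixed h, eq_comm]

theorem param_ne_zero_of_fixed {lam z : ℂ} (hz : z ≠ 0) (h : tanFamily lam z = z) : lam ≠ 0 := by
  rintro rfl
  simp [tanFamily] at h
  exact hz h.symm

/-- If `z ≠ 0` is an attracting fixed point, then `z` attracts one of the asymptotic values and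
`-z` attracts the other one. -/
theorem attracted_of_attracting_fixed {lam z : ℂ} (hz : z ≠ 0)
    (h : IsAttractingPeriodicPoint lam 1 z) :
    (IsAttractedTo lam (lam * Complex.I) {z} ∧ IsAttractedTo lam (-(lam * Complex.I)) {-z}) ∨
      (IsAttractedTo lam (lam * Complex.I) {-z} ∧ IsAttractedTo lam (-(lam * Complex.I)) {z}) := by
  have hf : tanFamily lam z = z := h.iterate_eq
  have hlam := param_ne_zero_of_fixed hz hf
  have hf' : tanFamily lam (-z) = -z := h.neg.iterate_eq
  obtain ⟨ε, hε, hball⟩ := h.neg.exists_ball_attracted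
  -- The disc omitted by the basin of z is a small disc around -z, which lies in the basin of -z.
  have := exists_asymptoticValue_attracted hlam h hε fun w hw hw' => by
    have h1 := mem_forwardOrbit_of_isAttractedTo h h.neg hw' (hball w hw)
    rw [forwardOrbit_of_fixed hf, Set.mem_singleton_iff] at h1
    exact hz (self_eq_neg.1 h1.symm)
  rw [forwardOrbit_of_fixed hf] at this
  rcases this with h1 | h1
  · exact Or.inl ⟨h1, by simpa using h1.neg⟩
  · exact Or.inr ⟨by simpa using h1.neg, h1⟩

/-- If `z ≠ 0` is an attracting fixed point, then `±z` are the only attracting periodic points. -/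
theorem eq_or_eq_neg_of_attracting_fixed {lam z w : ℂ} {p : ℕ} (hz : z ≠ 0)
    (h : IsAttractingPeriodicPoint lam 1 z) (hw : IsAttractingPeriodicPoint lam p w) :
    w = z ∨ w = -z := by
  have hf : tanFamily lam z = z := h.iterate_eq
  have hf' : tanFamily lam (-z) = -z := h.neg.iterate_eq
  have hlam := param_ne_zero_of_fixed hz hf
  by_cases hwz : w = z
  · exact Or.inl hwz
  obtain ⟨ε, hε, hball⟩ := h.exists_ball_attracted
  have key := exists_asymptoticValue_attracted hlam hw hε fun u hu hu' => by
    have h1 := mem_forwardOrbit_of_isAttractedTo h hw (hball u hu) hu'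
    rw [forwardOrbit_of_fixed hf, Set.mem_singleton_iff] at h1
    exact hwz h1
  have hpos : ∀ v, IsAttractedTo lam v (forwardOrbit lam w) →
      IsAttractedTo lam v {z} → w = z := by
    intro v h1 h2
    rw [← forwardOrbit_of_fixed hf] at h2
    have h1 := mem_forwardOrbit_of_isAttractedTo h hw h2 h1
    rwa [forwardOrbit_of_fixed hf, Set.mem_singleton_iff] at h1
  have hneg : ∀ v, IsAttractedTo lam v (forwardOrbit lam w) →
      IsAttractedTo lam v {-z} → w = -z := by
    intro v h1 h2
    rw [← forwardOrbit_of_fixed hf'] at h2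
    have h1 := mem_forwardOrbit_of_isAttractedTo h.neg hw h2 h1
    rwa [forwardOrbit_of_fixed hf', Set.mem_singleton_iff] at h1
  rcases attracted_of_attracting_fixed hz h with ⟨ha, hb⟩ | ⟨ha, hb⟩ <;> rcases key with hk | hk
  · exact Or.inl (hpos _ hk ha)
  · exact Or.inr (hneg _ hk hb)
  · exact Or.inr (hneg _ hk ha)
  · exact Or.inl (hpos _ hk hb)

/-! ### Persistence, openness and relative closedness -/

/-- Attracting periodic points persist under perturbation of the parameter. -/
theorem eventually_exists_attracting {lam₀ z₀ : ℂ} {p : ℕ}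
    (h : IsAttractingPeriodicPoint lam₀ p z₀) {ε : ℝ} (hε : 0 < ε) :
    ∀ᶠ lam in 𝓝 lam₀, ∃ z ∈ Metric.closedBall z₀ ε, ∃ q, q ∣ p ∧
      IsAttractingPeriodicPoint lam q z := by
  obtain ⟨hp, hO, -, hd⟩ := id h
  set μ := deriv ((tanFamily lam₀)^[p]) z₀ with hμ
  obtain ⟨c, hc1, hc2⟩ := exists_between hd
  have hc0 : 0 < c := (norm_nonneg _).trans_lt hc1
  set F : ℂ × ℂ → ℂ := fun x => (tanFamily x.1)^[p] x.2 with hF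
  have hcd : ContDiffAt ℂ 1 F (lam₀, z₀) := contDiffAt_tanFamily_iterate fun k _ => hO k
  have hs := hcd.hasStrictFDerivAt one_ne_zero
  set F' := fderiv ℂ F (lam₀, z₀)
  have hF' : ∀ v : ℂ, F' (0, v) = μ * v := by
    intro v
    have h1 : HasDerivAt (fun w : ℂ => (lam₀, w)) ((0 : ℂ), (1 : ℂ)) z₀ :=
      (hasDerivAt_const z₀ lam₀).prodMk (hasDerivAt_id z₀)
    have h2 : HasDerivAt ((tanFamily lam₀)^[p]) (F' (0, 1)) z₀ :=
      hs.hasFDerivAt.comp_hasDerivAt z₀ h1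
    have h3 : ((0 : ℂ), v) = v • ((0 : ℂ), (1 : ℂ)) := by simp
    rw [h3, map_smul, ← h2.deriv, smul_eq_mul, mul_comm]
  -- Strict differentiability in (λ, z) gives the contraction constant c uniformly for nearby
  -- parameters.
  have e1 := hs.isLittleO.def (sub_pos.2 hc1)
  obtain ⟨δ, hδ, H1⟩ := Metric.eventually_nhds_iff.1 e1
  have e2 : ∀ᶠ x in 𝓝 (lam₀, z₀), ∀ k < p,
      Complex.cos ((tanFamily x.1)^[k] x.2) ≠ 0 := by
    have : ∀ k ∈ Finset.range p, ∀ᶠ x in 𝓝 (lam₀, z₀),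
        Complex.cos ((tanFamily x.1)^[k] x.2) ≠ 0 := by
      intro k _
      have hk : ContinuousAt (fun x : ℂ × ℂ => Complex.cos ((tanFamily x.1)^[k] x.2))
          (lam₀, z₀) := Complex.continuous_cos.continuousAt.comp
        (contDiffAt_tanFamily_iterate fun k _ => hO k).continuousAt
      exact hk.eventually_ne (hO k)
    have := (Finset.eventually_all (Finset.range p)).2 this
    simpa using this
  obtain ⟨δ', hδ', H2⟩ := Metric.eventually_nhds_iff.1 e2
  obtain ⟨ρ, hρ, hρ'⟩ := exists_between (lt_min hε (lt_min hδ hδ'))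
  obtain ⟨hρε, hρδ, hρδ'⟩ : ρ < ε ∧ ρ < δ ∧ ρ < δ' := by simpa using hρ'
  -- A c-contraction that moves the centre by less than (1 - c)ρ maps the closed ρ-ball into itself.
  have e3 : ∀ᶠ lam in 𝓝 lam₀, ‖F (lam, z₀) - z₀‖ < (1 - c) * ρ := by
    have hcont : ContinuousAt (fun lam : ℂ => F (lam, z₀) - z₀) lam₀ := by
      have h1 : ContinuousAt (fun lam : ℂ => (lam, z₀)) lam₀ := by fun_prop
      exact (ContinuousAt.comp (g := F) (f := fun lam : ℂ => (lam, z₀)) hcd.continuousAt h1).sub continuousAt_const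
    have h0 : F (lam₀, z₀) - z₀ = 0 := sub_eq_zero.2 h.iterate_eq
    have := hcont.norm.eventually_lt (continuousAt_const (y := (1 - c) * ρ))
      (by simp only [h0, norm_zero]; exact mul_pos (by linarith) hρ)
    exact this
  filter_upwards [e3, Metric.ball_mem_nhds lam₀ (lt_min hδ hδ')] with lam h3 hlam
  obtain ⟨hl1, hl2⟩ : dist lam lam₀ < δ ∧ dist lam lam₀ < δ' := by simpa using hlam
  set g := (tanFamily lam)^[p] with hg
  have hlip : ∀ x y, dist x z₀ < δ → dist y z₀ < δ → ‖g x - g y‖ ≤ c * ‖x - y‖ := by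
    intro x y hx hy
    have h1 := @H1 ((lam, x), (lam, y)) (by
      simp only [Prod.dist_eq, max_lt_iff]; exact ⟨⟨hl1, hx⟩, ⟨hl1, hy⟩⟩)
    simp only [Prod.mk_sub_mk, sub_self, hF', Prod.norm_mk, norm_zero] at h1
    rw [max_eq_right (norm_nonneg _)] at h1
    have h2 : g x - g y = (g x - g y - μ * (x - y)) + μ * (x - y) := by ring
    rw [h2]
    refine (norm_add_le _ _).trans ?_
    rw [norm_mul]
    have h1' : ‖g x - g y - μ * (x - y)‖ ≤ (c - ‖μ‖) * ‖x - y‖ := h1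
    linarith
  have hmaps : Set.MapsTo g (Metric.closedBall z₀ ρ) (Metric.closedBall z₀ ρ) := by
    intro x hx
    rw [mem_closedBall_iff_norm] at hx ⊢
    have h1 := hlip x z₀ (by rw [dist_eq_norm]; linarith) (by simpa using hδ)
    have h2 : g x - z₀ = (g x - g z₀) + (g z₀ - z₀) := by ring
    rw [h2]
    refine (norm_add_le _ _).trans ?_
    have h3' : ‖g z₀ - z₀‖ < (1 - c) * ρ := h3
    nlinarith
  have hcontr : ContractingWith ⟨c, hc0.le⟩ (hmaps.restrict g _ _) := by
    refine ⟨by exact_mod_cast hc2, LipschitzWith.of_dist_le_mul fun x y => ?_⟩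
    have hx := Metric.mem_closedBall.1 x.2
    have hy := Metric.mem_closedBall.1 y.2
    have := hlip x y (by linarith) (by linarith)
    rwa [Subtype.dist_eq, Subtype.dist_eq, dist_eq_norm, dist_eq_norm]
  obtain ⟨z, hz, hfix, -⟩ := hcontr.exists_fixedPoint' Metric.isClosed_closedBall.isComplete hmaps
    (Metric.mem_closedBall_self hρ.le) (edist_ne_top _ _)
  have hz' := Metric.mem_closedBall.1 hz
  have hcos : ∀ k < p, Complex.cos ((tanFamily lam)^[k] z) ≠ 0 :=
    @H2 (lam, z) (by simp only [Prod.dist_eq, max_lt_iff]; exact ⟨hl2, by linarith⟩)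
  have hper : Function.IsPeriodicPt (tanFamily lam) p z := hfix
  refine ⟨z, Metric.closedBall_subset_closedBall hρε.le hz, _, hper.minimalPeriod_dvd, ?_⟩
  refine isAttractingPeriodicPoint_minimalPeriod hp (fun n => ?_) hfix ?_
  · rw [← hper.iterate_mod_apply]
    exact hcos _ (Nat.mod_lt _ hp)
  · refine (norm_deriv_le_of_lip' hc0.le ?_).trans_lt hc2
    have hzδ : dist z z₀ < δ := by linarith
    filter_upwards [Metric.isOpen_ball.mem_nhds (Metric.mem_ball.2 hzδ)] with x hx
    exact hlip x z hx hzδ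

/-- The parameters for which the tangent map has a nonzero attracting fixed point. -/
def nonzeroFixedParameters : Set ℂ := {lam | ∃ z ≠ 0, IsAttractingPeriodicPoint lam 1 z}

theorem nonzeroFixedParameters_subset : nonzeroFixedParameters ⊆ hyperbolicParameters := by
  rintro lam ⟨z, hz, h⟩
  exact ⟨param_ne_zero_of_fixed hz h.iterate_eq, 1, z, h⟩

theorem isOpen_nonzeroFixedParameters : IsOpen nonzeroFixedParameters := by
  rw [isOpen_iff_mem_nhds]
  rintro lam ⟨z, hz, h⟩
  have hz' : 0 < ‖z‖ := norm_pos_iff.2 hz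
  -- Radius |z|/2 keeps the perturbed fixed point away from 0.
  filter_upwards [eventually_exists_attracting h (half_pos hz')] with l hl
  obtain ⟨w, hw, q, hq, hw'⟩ := hl
  rw [Nat.dvd_one.1 hq] at hw'
  refine ⟨w, ?_, hw'⟩
  rintro rfl
  simp at hw
  linarith

/-- An attracting point at the limit parameter persists at nearby parameters of the set, where only
the pair ±z₁ is attracting. So it is a limit of fixed points, hence fixed. It is not 0, for
otherwise |λ₀| < 1 and 0 would be a third attracting fixed point nearby. -/
theorem closure_nonzeroFixedParameters_inter :
    closure nonzeroFixedParameters ∩ hyperbolicParameters ⊆ nonzeroFixedParameters := by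
  rintro lam₀ ⟨hcl, hlam₀, p, z, hz⟩
  have hfreq := mem_closure_iff_frequently.1 hcl
  have hcz : Complex.cos z ≠ 0 := hz.2.1 0
  have hfix : tanFamily lam₀ z = z := by
    by_contra hne
    have hcont : ContinuousAt (fun x : ℂ × ℂ => x.1 * Complex.tan x.2 - x.2) (lam₀, z) := by
      have : ContinuousAt (fun x : ℂ × ℂ => Complex.tan x.2) (lam₀, z) :=
        ContinuousAt.comp (g := Complex.tan) (Complex.continuousAt_tan.2 hcz) continuousAt_snd
      exact (continuousAt_fst.mul this).sub continuousAt_snd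
    have hev := hcont.eventually_ne (sub_ne_zero.2 hne)
    obtain ⟨δ, hδ, H⟩ := Metric.eventually_nhds_iff.1 hev
    obtain ⟨lam, ⟨z₁, hz₁, h₁⟩, ⟨w, hw, q, -, hw'⟩, hl⟩ :=
      (hfreq.and_eventually ((eventually_exists_attracting hz (half_pos hδ)).and
        (Metric.ball_mem_nhds lam₀ hδ))).exists
    have hww : tanFamily lam w = w := by
      rcases eq_or_eq_neg_of_attracting_fixed hz₁ h₁ hw' with rfl | rfl
      · exact h₁.iterate_eq
      · exact h₁.neg.iterate_eq
    refine @H (lam, w) ?_ (sub_eq_zero.2 hww)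
    simp only [Prod.dist_eq, max_lt_iff]
    exact ⟨hl, by have := Metric.mem_closedBall.1 hw; linarith⟩
  have hp : p = 1 := by
    rw [← hz.2.2.1]; exact Function.minimalPeriod_eq_one_iff_isFixedPt.2 hfix
  subst hp
  refine ⟨z, ?_, hz⟩
  rintro rfl
  have hlt : ‖lam₀‖ < 1 := by simpa using (isAttractingPeriodicPoint_one_iff.1 hz).2.2
  obtain ⟨lam, ⟨z₁, hz₁, h₁⟩, hl⟩ := (hfreq.and_eventually
    (continuous_norm.continuousAt.eventually_lt (continuousAt_const (y := (1 : ℝ))) hlt)).exists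
  have h0 : IsAttractingPeriodicPoint lam 1 0 :=
    isAttractingPeriodicPoint_one_iff.2 ⟨by simp, by simp [tanFamily], by simpa using hl⟩
  rcases eq_or_eq_neg_of_attracting_fixed hz₁ h₁ h0 with h | h
  · exact hz₁ h.symm
  · exact hz₁ (by simpa using h.symm)

/-- A preconnected open set that is relatively closed is a connected component. -/
theorem connectedComponentIn_eq_of_clopen {X : Type*} [TopologicalSpace X] {A H : Set X} {x : X}
    (hA : IsPreconnected A) (hAo : IsOpen A) (hAH : A ⊆ H) (hcl : closure A ∩ H ⊆ A)
    (hx : x ∈ A) : connectedComponentIn H x = A := by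
  refine Set.Subset.antisymm ?_ (hA.subset_connectedComponentIn hx hAH)
  have hsub := connectedComponentIn_subset H x
  refine isPreconnected_connectedComponentIn.subset_left_of_subset_union hAo
    isClosed_closure.isOpen_compl (Set.disjoint_left.2 fun y hy hy' => hy' (subset_closure hy))
    (fun y hy => ?_) ⟨x, mem_connectedComponentIn (hAH hx), hx⟩
  by_cases hy' : y ∈ closure A
  · exact Or.inl (hcl ⟨hy', hsub hy⟩)
  · exact Or.inr hy'

theorem encard_attractingFixedPoints {lam : ℂ} (h : lam ∈ nonzeroFixedParameters) :
    (attractingFixedPoints lam).encard = 2 := by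
  obtain ⟨z, hz, h⟩ := h
  have : attractingFixedPoints lam = {z, -z} := by
    ext w
    constructor
    · exact fun hw => eq_or_eq_neg_of_attracting_fixed hz h hw
    · rintro (rfl | rfl)
      · exact h
      · exact h.neg
  rw [this, Set.encard_pair]
  exact fun h' => hz (self_eq_neg.1 h')

theorem mem_nonzeroFixedParameters_of_two_le {lam : ℂ}
    (h : 2 ≤ (attractingFixedPoints lam).encard) : lam ∈ nonzeroFixedParameters := by
  have h1 : 1 < (attractingFixedPoints lam).encard :=
    lt_of_lt_of_le (by norm_num) h
  obtain ⟨a, b, ha, hb, hab⟩ := Set.one_lt_encard_iff.1 h1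
  by_cases h0 : a = 0
  · exact ⟨b, fun hb0 => hab (h0.trans hb0.symm), hb⟩
  · exact ⟨a, h0, ha⟩

/-! ### The region |w| < |sin w| as the part above a graph -/

theorem Complex.norm_sin_sq (w : ℂ) : ‖Complex.sin w‖ ^ 2 = Real.sin w.re ^ 2 + Real.sinh w.im ^ 2 := by
  rw [Complex.sin_eq, ← Complex.ofReal_sin, ← Complex.ofReal_cos, ← Complex.ofReal_cosh,
    ← Complex.ofReal_sinh, ← Complex.ofReal_mul, ← Complex.ofReal_mul, Complex.sq_norm,
    Complex.normSq_add_mul_I]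
  have h1 := Real.sin_sq_add_cos_sq w.re
  have h2 := Real.cosh_sq w.im
  rw [mul_pow, mul_pow, h2]
  linear_combination Real.sinh w.im ^ 2 * h1

theorem Complex.norm_sq_eq_re_sq_add_im_sq (w : ℂ) : ‖w‖ ^ 2 = w.re ^ 2 + w.im ^ 2 := by
  rw [Complex.sq_norm, Complex.normSq_apply]; ring

/-- The odd extension of `y ↦ sinh² y - y²`. -/
noncomputable def sinhSqSub (y : ℝ) : ℝ := (Real.sinh y - y) * |Real.sinh y + y|

theorem sinhSqSub_neg (y : ℝ) : sinhSqSub (-y) = -sinhSqSub y := by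
  have : |-Real.sinh y + -y| = |Real.sinh y + y| := by rw [← neg_add, abs_neg]
  rw [sinhSqSub, sinhSqSub, Real.sinh_neg, this]; ring

theorem sinhSqSub_of_nonneg {y : ℝ} (hy : 0 ≤ y) : sinhSqSub y = Real.sinh y ^ 2 - y ^ 2 := by
  have := Real.sinh_nonneg_iff.2 hy
  rw [sinhSqSub, abs_of_nonneg (by linarith)]; ring

/-- For y ≥ 0 both factors sinh y - y and sinh y + y increase. The odd extension makes the function
an order isomorphism of the whole line, so its inverse is continuous. -/
theorem strictMono_sinhSqSub : StrictMono sinhSqSub := by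
  refine strictMono_of_odd_strictMonoOn_nonneg sinhSqSub_neg ?_
  intro a ha b hb hab
  have ha' : (0 : ℝ) ≤ a := ha
  have hb' : (0 : ℝ) ≤ b := hb
  have h1 : Real.sinh a - a < Real.sinh b - b := Real.sinh_sub_id_strictMono hab
  have h2 : Real.sinh a < Real.sinh b := Real.sinh_lt_sinh.2 hab
  have h3 := Real.self_le_sinh_iff.2 ha'
  have h4 := Real.self_le_sinh_iff.2 hb'
  rw [sinhSqSub, sinhSqSub, abs_of_nonneg (by linarith), abs_of_nonneg (by linarith)]
  exact mul_lt_mul'' h1 (by linarith) (by linarith) (by linarith)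

theorem continuous_sinhSqSub : Continuous sinhSqSub := by
  unfold sinhSqSub
  have := Real.continuous_sinh
  fun_prop

theorem surjective_sinhSqSub : Function.Surjective sinhSqSub := by
  have hpos : 0 < Real.sinh 1 - 1 := sub_pos.2 (Real.self_lt_sinh_iff.2 one_pos)
  have htop : Tendsto sinhSqSub atTop atTop := by
    refine tendsto_atTop_mono' atTop ?_ (tendsto_id.const_mul_atTop hpos)
    filter_upwards [eventually_ge_atTop 1] with y hy
    have h1 : Real.sinh 1 - 1 ≤ Real.sinh y - y := Real.sinh_sub_id_strictMono.monotone hy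
    have h2 := Real.self_le_sinh_iff.2 (zero_le_one.trans hy)
    rw [sinhSqSub, abs_of_nonneg (by linarith)]
    simp only [id]
    exact mul_le_mul h1 (by linarith) (by linarith) (by linarith)
  refine continuous_sinhSqSub.surjective htop ?_
  have h2 := tendsto_neg_atTop_atBot.comp (htop.comp tendsto_neg_atBot_atTop)
  refine h2.congr fun y => ?_
  simp [sinhSqSub_neg]

/-- The height over `x` of the curve `|sin w| = |w|` in the upper half plane. -/
noncomputable def sinCurveHeight (x : ℝ) : ℝ :=
  (strictMono_sinhSqSub.orderIsoOfSurjective _ surjective_sinhSqSub).symm (x ^ 2 - Real.sin x ^ 2)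

theorem continuous_sinCurveHeight : Continuous sinCurveHeight := by
  refine (OrderIso.continuous _).comp ?_
  fun_prop

theorem sinhSqSub_sinCurveHeight (x : ℝ) :
    sinhSqSub (sinCurveHeight x) = x ^ 2 - Real.sin x ^ 2 :=
  (strictMono_sinhSqSub.orderIsoOfSurjective _ surjective_sinhSqSub).apply_symm_apply _

theorem sinCurveHeight_nonneg (x : ℝ) : 0 ≤ sinCurveHeight x := by
  rw [← strictMono_sinhSqSub.le_iff_le, sinhSqSub_sinCurveHeight]
  have h : Real.sin x ^ 2 ≤ x ^ 2 := sq_le_sq.2 Real.abs_sin_le_abs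
  simp [sinhSqSub, h]

/-- Since |sin(x + iy)|² = sin² x + sinh² y, the variables separate: x² - sin² x < sinh² y - y². -/
theorem norm_lt_norm_sin_iff {w : ℂ} (hw : 0 ≤ w.im) :
    ‖w‖ < ‖Complex.sin w‖ ↔ sinCurveHeight w.re < w.im := by
  rw [← strictMono_sinhSqSub.lt_iff_lt (a := sinCurveHeight w.re), sinhSqSub_sinCurveHeight,
    sinhSqSub_of_nonneg hw,
    ← pow_lt_pow_iff_left₀ (norm_nonneg _) (norm_nonneg _) two_ne_zero, Complex.norm_sin_sq,
    Complex.norm_sq_eq_re_sq_add_im_sq]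
  constructor <;> intro h <;> linarith

theorem norm_eq_norm_sin {w : ℂ} (hw : sinCurveHeight w.re = w.im) :
    ‖w‖ = ‖Complex.sin w‖ := by
  have h0 : 0 ≤ w.im := hw ▸ sinCurveHeight_nonneg _
  have h1 := sinhSqSub_sinCurveHeight w.re
  rw [hw, sinhSqSub_of_nonneg h0] at h1
  rw [← pow_left_inj₀ (norm_nonneg _) (norm_nonneg _) two_ne_zero, Complex.norm_sin_sq,
    Complex.norm_sq_eq_re_sq_add_im_sq]
  linarith

theorem norm_le_norm_sin {w : ℂ} (hw : sinCurveHeight w.re ≤ w.im) :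
    ‖w‖ ≤ ‖Complex.sin w‖ := by
  rcases hw.lt_or_eq with h | h
  · exact ((norm_lt_norm_sin_iff ((sinCurveHeight_nonneg _).trans hw)).2 h).le
  · exact (norm_eq_norm_sin h).le

theorem im_ne_zero_of_norm_lt_norm_sin {w : ℂ} (hw : ‖w‖ < ‖Complex.sin w‖) : w.im ≠ 0 := by
  intro h
  have h1 := (norm_lt_norm_sin_iff h.ge).1 hw
  exact absurd h1 (by rw [h]; exact not_lt.2 (sinCurveHeight_nonneg _))

/-! ### The parametrization by w ↦ (w/2) cot(w/2) -/

/-- The parameter `(w / 2) cot (w / 2)` for which `w / 2` is a fixed point. -/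
noncomputable def fixedPointParam (w : ℂ) : ℂ :=
  Complex.cos (w / 2) / dslope Complex.sin 0 (w / 2)

theorem dslope_sin_of_ne {v : ℂ} (hv : v ≠ 0) : dslope Complex.sin 0 v = Complex.sin v / v := by
  rw [dslope_of_ne _ hv, slope_def_field]; simp

theorem fixedPointParam_zero : fixedPointParam 0 = 1 := by
  simp [fixedPointParam]

theorem fixedPointParam_of_ne {w : ℂ} (hw : w ≠ 0) :
    fixedPointParam w = w / 2 * Complex.cos (w / 2) / Complex.sin (w / 2) := by
  rw [fixedPointParam, dslope_sin_of_ne (by simpa using hw), div_div_eq_mul_div, mul_comm]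

theorem sin_eq_two_mul_half (w : ℂ) :
    Complex.sin w = 2 * Complex.sin (w / 2) * Complex.cos (w / 2) := by
  rw [← Complex.sin_two_mul]; congr 1; ring

theorem sin_half_ne_zero {w : ℂ} (hw : w ≠ 0) (h : ‖w‖ ≤ ‖Complex.sin w‖) :
    Complex.sin (w / 2) ≠ 0 := by
  intro h0
  rw [sin_eq_two_mul_half, h0] at h
  simp at h
  exact hw h

/-- The non-strict hypothesis covers the boundary curve, which passes through 0. Elsewhere it forces
sin(w/2) ≠ 0; at 0 the `dslope` removes the singularity. -/
theorem continuousAt_fixedPointParam {w : ℂ} (h : ‖w‖ ≤ ‖Complex.sin w‖) :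
    ContinuousAt fixedPointParam w := by
  have hcont : Continuous (dslope Complex.sin 0) := by
    rw [← continuousOn_univ]
    exact (continuousOn_dslope Filter.univ_mem).2
      ⟨Complex.continuous_sin.continuousOn, Complex.differentiable_sin 0⟩
  have h1 : Continuous fun w : ℂ => dslope Complex.sin 0 (w / 2) := by fun_prop
  have h2 : Continuous fun w : ℂ => Complex.cos (w / 2) := by fun_prop
  refine h2.continuousAt.div h1.continuousAt ?_
  by_cases hw : w = 0
  · simp [hw]
  · rw [dslope_sin_of_ne (by simpa using hw)]
    exact div_ne_zero (sin_half_ne_zero hw h) (by simpa using hw)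

/-- Solving λ tan z = z gives λ = z cot z, and the multiplier λ / cos² z becomes 2z / sin 2z. -/
theorem isAttractingPeriodicPoint_one_iff_param {lam z : ℂ} (hz : z ≠ 0) :
    IsAttractingPeriodicPoint lam 1 z ↔
      ‖2 * z‖ < ‖Complex.sin (2 * z)‖ ∧ lam = fixedPointParam (2 * z) := by
  have hz2 : 2 * z ≠ 0 := by simpa using hz
  rw [isAttractingPeriodicPoint_one_iff, fixedPointParam_of_ne hz2, Complex.sin_two_mul,
    mul_div_cancel_left₀ _ two_ne_zero]
  constructor
  · rintro ⟨hc, hf, hd⟩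
    rw [tanFamily, Complex.tan_eq_sin_div_cos] at hf
    have hs : Complex.sin z ≠ 0 := by
      rintro h0
      rw [h0] at hf
      simp at hf
      exact hz hf.symm
    have hl : lam = z * Complex.cos z / Complex.sin z := by
      field_simp at hf ⊢
      exact hf
    refine ⟨?_, hl⟩
    have h1 : lam / Complex.cos z ^ 2 = 2 * z / (2 * Complex.sin z * Complex.cos z) := by
      rw [hl]; field_simp
    rw [h1, norm_div, div_lt_one (norm_pos_iff.2 (by simp [hs, hc]))] at hd
    exact hd
  · rintro ⟨h, rfl⟩
    have hne := norm_pos_iff.1 ((norm_nonneg _).trans_lt h)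
    have hc : Complex.cos z ≠ 0 := by rintro h0; simp [h0] at hne
    have hs : Complex.sin z ≠ 0 := by rintro h0; simp [h0] at hne
    refine ⟨hc, ?_, ?_⟩
    · rw [tanFamily, Complex.tan_eq_sin_div_cos]; field_simp
    · have h1 : z * Complex.cos z / Complex.sin z / Complex.cos z ^ 2 =
          2 * z / (2 * Complex.sin z * Complex.cos z) := by field_simp
      rwa [h1, norm_div, div_lt_one (norm_pos_iff.2 hne)]

/-- The part of `|w| < |sin w|` in the upper half plane. -/
def aboveSinCurve : Set ℂ := {w | sinCurveHeight w.re < w.im}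

theorem norm_lt_of_mem_aboveSinCurve {w : ℂ} (hw : w ∈ aboveSinCurve) :
    ‖w‖ < ‖Complex.sin w‖ :=
  (norm_lt_norm_sin_iff ((sinCurveHeight_nonneg _).trans (le_of_lt hw))).2 hw

theorem ne_zero_of_mem_aboveSinCurve {w : ℂ} (hw : w ∈ aboveSinCurve) : w ≠ 0 := by
  rintro rfl
  simpa using norm_lt_of_mem_aboveSinCurve hw

theorem isAttractingPeriodicPoint_half {w : ℂ} (hw : w ∈ aboveSinCurve) :
    IsAttractingPeriodicPoint (fixedPointParam w) 1 (w / 2) := by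
  have h0 := ne_zero_of_mem_aboveSinCurve hw
  rw [isAttractingPeriodicPoint_one_iff_param (by simpa using h0),
    mul_div_cancel₀ _ two_ne_zero]
  exact ⟨norm_lt_of_mem_aboveSinCurve hw, rfl⟩

theorem image_fixedPointParam : fixedPointParam '' aboveSinCurve = nonzeroFixedParameters := by
  ext lam
  constructor
  · rintro ⟨w, hw, rfl⟩
    exact ⟨w / 2, by simpa using ne_zero_of_mem_aboveSinCurve hw,
      isAttractingPeriodicPoint_half hw⟩
  · rintro ⟨z, hz, h⟩
    -- The fixed points come in pairs ±z off the real axis, so the upper half plane suffices.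
    wlog him : 0 < z.im generalizing z
    · have h1 := ((isAttractingPeriodicPoint_one_iff_param hz).1 h).1
      have h2 := im_ne_zero_of_norm_lt_norm_sin h1
      refine this (-z) (neg_ne_zero.2 hz) h.neg ?_
      have h3 : z.im ≠ 0 := by simpa using h2
      rw [Complex.neg_im]
      exact neg_pos.2 (lt_of_le_of_ne (not_lt.1 him) h3)
    · obtain ⟨h1, h2⟩ := (isAttractingPeriodicPoint_one_iff_param hz).1 h
      refine ⟨2 * z, (norm_lt_norm_sin_iff ?_).1 h1, h2.symm⟩
      simpa using him.le

theorem isPreconnected_nonzeroFixedParameters : IsPreconnected nonzeroFixedParameters := by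
  rw [← image_fixedPointParam]
  refine IsPreconnected.image ?_ _ fun w hw =>
    (continuousAt_fixedPointParam (norm_lt_of_mem_aboveSinCurve hw).le).continuousWithinAt
  -- A vertical shear carries the upper half plane onto the region.
  have h1 : aboveSinCurve = (fun x : ℝ × ℝ =>
      (x.1 : ℂ) + ((sinCurveHeight x.1 + x.2 : ℝ) : ℂ) * Complex.I) '' (Set.univ ×ˢ Set.Ioi 0) := by
    ext w
    constructor
    · intro hw
      refine ⟨(w.re, w.im - sinCurveHeight w.re), ⟨trivial, Set.mem_Ioi.2 (sub_pos.2 (show _ < _ from hw))⟩, ?_⟩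
      simp only [add_sub_cancel]
      exact Complex.re_add_im w
    · rintro ⟨⟨a, b⟩, ⟨-, hb⟩, rfl⟩
      have hb' : 0 < b := hb
      simpa [aboveSinCurve] using hb'
  rw [h1]
  refine (isPreconnected_univ.prod isPreconnected_Ioi).image _ (Continuous.continuousOn ?_)
  have := continuous_sinCurveHeight
  fun_prop

theorem norm_sin_eq_of_re_eq_zero (t : ℝ) : ‖Complex.sin (t * Complex.I)‖ = |Real.sinh t| := by
  rw [Complex.sin_mul_I, norm_mul, Complex.norm_I, mul_one, ← Complex.ofReal_sinh,
    Complex.norm_real, Real.norm_eq_abs]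

theorem mul_I_mem_aboveSinCurve {t : ℝ} (ht : 0 < t) : (t : ℂ) * Complex.I ∈ aboveSinCurve := by
  refine (norm_lt_norm_sin_iff (by simpa using ht.le)).1 ?_
  rw [norm_sin_eq_of_re_eq_zero, abs_of_pos (Real.sinh_pos_iff.2 ht), norm_mul, Complex.norm_I,
    mul_one, Complex.norm_real, Real.norm_of_nonneg ht.le]
  exact Real.self_lt_sinh_iff.2 ht

theorem fixedPointParam_mul_I {t : ℝ} (ht : 0 < t) :
    fixedPointParam (t * Complex.I) =
      ((t / 2 * Real.cosh (t / 2) / Real.sinh (t / 2) : ℝ) : ℂ) := by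
  have h0 : (t : ℂ) * Complex.I ≠ 0 := ne_zero_of_mem_aboveSinCurve (mul_I_mem_aboveSinCurve ht)
  have h1 : (t : ℂ) * Complex.I / 2 = ((t / 2 : ℝ) : ℂ) * Complex.I := by push_cast; ring
  rw [fixedPointParam_of_ne h0, h1, Complex.cos_mul_I, Complex.sin_mul_I, ← Complex.ofReal_cosh,
    ← Complex.ofReal_sinh]
  have h2 : ((Real.sinh (t / 2) : ℝ) : ℂ) ≠ 0 :=
    Complex.ofReal_ne_zero.2 (Real.sinh_pos_iff.2 (half_pos ht)).ne'
  push_cast at h2 ⊢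
  field_simp

/-- On w = is the parameter is (s/2) coth(s/2), which tends to 1 as s → 0 and exceeds t at s = 2t;
the intermediate value theorem applies. -/
theorem ofReal_mem_nonzeroFixedParameters {t : ℝ} (ht : 1 < t) :
    (t : ℂ) ∈ nonzeroFixedParameters := by
  have hcont : ContinuousOn (fun s : ℝ => (fixedPointParam (s * Complex.I)).re)
      (Set.Icc 0 (2 * t)) := by
    intro s hs
    refine ContinuousAt.continuousWithinAt ?_
    have h1 : ContinuousAt (fun s : ℝ => (s : ℂ) * Complex.I) s := by fun_prop
    refine Complex.continuous_re.continuousAt.comp (ContinuousAt.comp (g := fixedPointParam)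
      (f := fun s : ℝ => (s : ℂ) * Complex.I)
      (continuousAt_fixedPointParam ?_) h1)
    rcases hs.1.lt_or_eq with h | h
    · exact (norm_lt_of_mem_aboveSinCurve (mul_I_mem_aboveSinCurve h)).le
    · simp [← h]
  have hmem : t ∈ Set.Icc ((fixedPointParam ((0 : ℝ) * Complex.I)).re)
      ((fixedPointParam ((2 * t : ℝ) * Complex.I)).re) := by
    refine ⟨by simp [fixedPointParam_zero, ht.le], ?_⟩
    rw [fixedPointParam_mul_I (by linarith), Complex.ofReal_re, mul_div_cancel_left₀ _ two_ne_zero]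
    have h1 : 0 < Real.sinh t := Real.sinh_pos_iff.2 (by linarith)
    rw [le_div_iff₀ h1]
    exact mul_le_mul_of_nonneg_left (Real.sinh_lt_cosh t).le (by linarith)
  obtain ⟨s, hs, hst⟩ := intermediate_value_Icc (by linarith) hcont hmem
  simp only at hst
  have hs0 : 0 < s := by
    refine lt_of_le_of_ne hs.1 ?_
    rintro rfl
    simp [fixedPointParam_zero] at hst
    linarith
  rw [← image_fixedPointParam]
  refine ⟨s * Complex.I, mul_I_mem_aboveSinCurve hs0, ?_⟩
  rw [fixedPointParam_mul_I hs0, Complex.ofReal_re] at hst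
  rw [fixedPointParam_mul_I hs0, hst]

/-! ### Asymptotics of the parametrization -/

theorem Complex.norm_sin_le_cosh (w : ℂ) : ‖Complex.sin w‖ ≤ Real.cosh w.im := by
  rw [← pow_le_pow_iff_left₀ (norm_nonneg _) (Real.cosh_pos _).le two_ne_zero,
    Complex.norm_sin_sq, Real.cosh_sq]
  linarith [Real.sin_sq_le_one w.re]

theorem Real.cosh_le_exp {y : ℝ} (hy : 0 ≤ y) : Real.cosh y ≤ Real.exp y := by
  have h : Real.exp (-y) ≤ Real.exp y := Real.exp_le_exp.2 (by linarith)
  rw [Real.cosh_eq]; linarith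

/-- Where `|w| ≤ |sin w|` and `Im w ≥ 1`, the map `(w / 2) cot (w / 2)` is a bounded perturbation
of `-i w / 2`. -/
theorem norm_fixedPointParam_add_le {w : ℂ} (h : ‖w‖ ≤ ‖Complex.sin w‖) (him : 1 ≤ w.im) :
    ‖fixedPointParam w + Complex.I * w / 2‖ ≤ 2 := by
  have h0 : w ≠ 0 := by rintro rfl; norm_num at him
  have hs := sin_half_ne_zero h0 h
  have hq2 : Complex.exp (Complex.I * w) =
      (Complex.cos (w / 2) + Complex.sin (w / 2) * Complex.I) ^ 2 := by
    rw [← Complex.exp_mul_I, ← Complex.exp_nat_mul]; congr 1; push_cast; ring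
  have hI := Complex.I_sq
  have hcs := Complex.sin_sq_add_cos_sq (w / 2)
  set q := Complex.exp (Complex.I * w) with hq
  have hqn : ‖q‖ ≤ 1 / 2 := by
    rw [hq, Complex.norm_exp]
    have h1 : (Complex.I * w).re = -w.im := by simp
    rw [h1]
    calc Real.exp (-w.im) ≤ Real.exp (-1) := Real.exp_le_exp.2 (by linarith)
      _ ≤ 1 / 2 := by
        rw [Real.exp_neg, inv_le_comm₀ (Real.exp_pos _) (by norm_num)]
        have := Real.add_one_le_exp 1
        norm_num at this ⊢
        linarith
  have hq1 : 1 / 2 ≤ ‖q - 1‖ := by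
    have := norm_sub_norm_le (1 : ℂ) q
    rw [norm_one, norm_sub_rev] at this
    linarith
  -- Here |w| ≤ |sin w| enters: q sin w = i(1 - q²)/2 is bounded.
  have hwq : ‖w * q‖ ≤ 1 := by
    have h1 : Complex.sin w * q = (1 - q ^ 2) * Complex.I / 2 := by
      have h2 : Complex.exp (-w * Complex.I) * q = 1 := by
        rw [hq, ← Complex.exp_add]; simp [mul_comm]
      have h3 : Complex.exp (w * Complex.I) = q := by rw [hq, mul_comm]
      rw [Complex.sin, h3]
      linear_combination Complex.I / 2 * h2
    have h4 : ‖w * q‖ ≤ ‖Complex.sin w * q‖ := by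
      rw [norm_mul, norm_mul]; gcongr
    refine h4.trans ?_
    rw [h1, norm_div, norm_mul, Complex.norm_I, mul_one, Complex.norm_ofNat]
    have h5 : ‖1 - q ^ 2‖ ≤ 1 + ‖q‖ ^ 2 := by
      refine (norm_sub_le _ _).trans ?_
      rw [norm_one, norm_pow]
    have h6 : ‖q‖ ^ 2 ≤ 1 := pow_le_one₀ (norm_nonneg _) (by linarith)
    linarith
  have hq10 : q - 1 ≠ 0 := norm_pos_iff.1 (by linarith)
  -- From cot(w/2) = i(q + 1)/(q - 1) with q = e^{iw}.
  have key : fixedPointParam w + Complex.I * w / 2 = Complex.I * (w * q) / (q - 1) := by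
    rw [eq_div_iff hq10, fixedPointParam_of_ne h0]
    field_simp
    rw [hq2]
    set s := Complex.sin (w / 2)
    set c := Complex.cos (w / 2)
    have e1 : c * ((c + s * Complex.I) ^ 2 - 1) =
        Complex.I * s * ((c + s * Complex.I) ^ 2 + 1) := by
      linear_combination c * hcs + Complex.I * s * hcs - (c * s ^ 2 + s ^ 3 * Complex.I) * hI
    linear_combination e1
  rw [key, norm_div, norm_mul, Complex.norm_I, one_mul, div_le_iff₀ (by linarith)]
  linarith

/-- Properness of the parametrization, for the compactness argument at the boundary. For Im w ≤ 1
already |w| ≤ |sin w| ≤ e < 4. -/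
theorem norm_le_of_norm_le_norm_sin {w : ℂ} (h : ‖w‖ ≤ ‖Complex.sin w‖) (him : 0 ≤ w.im) :
    ‖w‖ ≤ 2 * ‖fixedPointParam w‖ + 4 := by
  rcases le_total 1 w.im with h1 | h1
  · have h2 := norm_fixedPointParam_add_le h h1
    have h3 : ‖Complex.I * w / 2‖ ≤
        ‖fixedPointParam w + Complex.I * w / 2‖ + ‖fixedPointParam w‖ := by
      have := norm_sub_le (fixedPointParam w + Complex.I * w / 2) (fixedPointParam w)
      rwa [add_sub_cancel_left] at this
    rw [norm_div, norm_mul, Complex.norm_I, one_mul, Complex.norm_ofNat] at h3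
    linarith
  · have h2 := (Complex.norm_sin_le_cosh w).trans (Real.cosh_le_exp him)
    have h3 : Real.exp w.im ≤ Real.exp 1 := Real.exp_le_exp.2 h1
    have h4 := Real.exp_one_lt_d9
    have := norm_nonneg (fixedPointParam w)
    norm_num at h4
    linarith

/-! ### The boundary curve and its growth -/

/-- The curve `|sin w| = |w|` in the upper half plane, as a graph over the real line. -/
noncomputable def sinCurve (s : ℝ) : ℂ := s + sinCurveHeight s * Complex.I

@[simp] theorem sinCurve_re (s : ℝ) : (sinCurve s).re = s := by simp [sinCurve]

@[simp] theorem sinCurve_im (s : ℝ) : (sinCurve s).im = sinCurveHeight s := by simp [sinCurve]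

theorem norm_sinCurve (s : ℝ) : ‖sinCurve s‖ = ‖Complex.sin (sinCurve s)‖ :=
  norm_eq_norm_sin (by simp)

theorem continuous_fixedPointParam_sinCurve : Continuous fun s => fixedPointParam (sinCurve s) := by
  have h : Continuous sinCurve := by
    unfold sinCurve
    have := continuous_sinCurveHeight
    fun_prop
  exact continuous_iff_continuousAt.2 fun s =>
    ContinuousAt.comp (g := fixedPointParam)
      (continuousAt_fixedPointParam (norm_sinCurve s).le) h.continuousAt

theorem sinCurve_add_mem {s t : ℝ} (ht : 0 < t) : sinCurve s + t * Complex.I ∈ aboveSinCurve := by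
  simpa [aboveSinCurve] using ht

theorem tendsto_sinCurve_add (s : ℝ) :
    Tendsto (fun t : ℝ => sinCurve s + t * Complex.I) (𝓝[>] 0) (𝓝 (sinCurve s)) := by
  have h : Continuous fun t : ℝ => sinCurve s + t * Complex.I := by fun_prop
  simpa using (h.tendsto 0).mono_left nhdsWithin_le_nhds

theorem tendsto_fixedPointParam_sinCurve_add (s : ℝ) :
    Tendsto (fun t : ℝ => fixedPointParam (sinCurve s + t * Complex.I)) (𝓝[>] 0)
      (𝓝 (fixedPointParam (sinCurve s))) :=
  (continuousAt_fixedPointParam (norm_sinCurve s).le).tendsto.comp (tendsto_sinCurve_add s)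

/-- The parametrization is not known to be injective on the closed region, so another fixed point z
must be excluded. If z were attracting, it would persist at the parameters of points just above the
curve, whose only attracting points are ±w/2. In the limit z = ±`sinCurve s` / 2, where the
multiplier has modulus 1. -/
theorem fixedPointParam_sinCurve_notMem (s : ℝ) :
    fixedPointParam (sinCurve s) ∉ nonzeroFixedParameters := by
  rintro ⟨z, hz, h⟩
  have hlt := ((isAttractingPeriodicPoint_one_iff_param hz).1 h).1
  have key : ∀ ε > 0, dist (sinCurve s / 2) z ≤ ε ∨ dist (-(sinCurve s / 2)) z ≤ ε := by
    intro ε hε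
    have hcl : IsClosed ({u : ℂ | dist (u / 2) z ≤ ε} ∪ {u : ℂ | dist (-(u / 2)) z ≤ ε}) :=
      (isClosed_le (by fun_prop) continuous_const).union
        (isClosed_le (by fun_prop) continuous_const)
    refine hcl.mem_of_tendsto (tendsto_sinCurve_add s) ?_
    filter_upwards [(tendsto_fixedPointParam_sinCurve_add s).eventually
      (eventually_exists_attracting h hε), self_mem_nhdsWithin] with t ht ht0
    obtain ⟨w, hw, q, -, hw'⟩ := ht
    have hmem := sinCurve_add_mem (s := s) ht0
    have h0 := ne_zero_of_mem_aboveSinCurve hmem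
    rcases eq_or_eq_neg_of_attracting_fixed (by simpa using h0)
      (isAttractingPeriodicPoint_half hmem) hw' with rfl | rfl
    · exact Or.inl hw
    · exact Or.inr hw
  have heq : z = sinCurve s / 2 ∨ z = -(sinCurve s / 2) := by
    by_contra! hne
    have h1 : 0 < dist (sinCurve s / 2) z := dist_pos.2 hne.1.symm
    have h2 : 0 < dist (-(sinCurve s / 2)) z := dist_pos.2 hne.2.symm
    obtain ⟨ε, hε, hε'⟩ := exists_between (lt_min h1 h2)
    rw [lt_min_iff] at hε'
    rcases key ε hε with h | h <;> linarith
  rcases heq with rfl | rfl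
  · rw [mul_div_cancel₀ _ two_ne_zero, norm_sinCurve] at hlt
    exact lt_irrefl _ hlt
  · rw [mul_neg, mul_div_cancel₀ _ two_ne_zero, Complex.sin_neg, norm_neg, norm_neg,
      norm_sinCurve] at hlt
    exact lt_irrefl _ hlt

theorem range_fixedPointParam_sinCurve :
    Set.range (fun s => fixedPointParam (sinCurve s)) = frontier nonzeroFixedParameters := by
  rw [isOpen_nonzeroFixedParameters.frontier_eq]
  ext lam
  constructor
  · rintro ⟨s, rfl⟩
    refine ⟨mem_closure_of_tendsto (tendsto_fixedPointParam_sinCurve_add s) ?_,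
      fixedPointParam_sinCurve_notMem s⟩
    filter_upwards [self_mem_nhdsWithin] with t ht
    rw [← image_fixedPointParam]
    exact ⟨_, sinCurve_add_mem ht, rfl⟩
  · rintro ⟨hcl, hnot⟩
    obtain ⟨x, hx, hlim⟩ := mem_closure_iff_seq_limit.1 hcl
    rw [← image_fixedPointParam] at hx
    choose w hw hwx using hx
    obtain rfl : (fun n => fixedPointParam (w n)) = x := funext hwx
    have him : ∀ n, 0 ≤ (w n).im := fun n => (sinCurveHeight_nonneg _).trans (le_of_lt (hw n))
    obtain ⟨R, hR⟩ := hlim.norm.bddAbove_range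
    have hbound : ∀ n, w n ∈ Metric.closedBall (0 : ℂ) (2 * R + 4) := by
      intro n
      have h1 := norm_le_of_norm_le_norm_sin (norm_lt_of_mem_aboveSinCurve (hw n)).le (him n)
      have h2 : ‖fixedPointParam (w n)‖ ≤ R := hR ⟨n, rfl⟩
      simp only [mem_closedBall_zero_iff]
      linarith
    obtain ⟨u, -, φ, hφ, hu⟩ := (isCompact_closedBall (0 : ℂ) _).tendsto_subseq hbound
    have hule : sinCurveHeight u.re ≤ u.im := by
      have hc := continuous_sinCurveHeight
      have : IsClosed {u : ℂ | sinCurveHeight u.re ≤ u.im} :=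
        isClosed_le (by fun_prop) Complex.continuous_im
      exact this.mem_of_tendsto hu (Eventually.of_forall fun n =>
        Set.mem_ofPred.2 (le_of_lt (hw (φ n))))
    have hlim' : Tendsto (fun n => fixedPointParam (w (φ n))) atTop (𝓝 (fixedPointParam u)) :=
      (continuousAt_fixedPointParam (norm_le_norm_sin hule)).tendsto.comp hu
    have hlam : fixedPointParam u = lam :=
      tendsto_nhds_unique hlim' (hlim.comp hφ.tendsto_atTop)
    -- A limit strictly above the curve would put the parameter inside the set.
    rcases hule.lt_or_eq with h | h
    · refine absurd ?_ hnot
      rw [← image_fixedPointParam]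
      exact ⟨u, h, hlam⟩
    · refine ⟨u.re, ?_⟩
      have : sinCurve u.re = u := by rw [sinCurve, h, Complex.re_add_im]
      simp only [this, hlam]

theorem abs_le_exp_sinCurveHeight (s : ℝ) : |s| ≤ Real.exp (sinCurveHeight s) := by
  have h1 := Complex.abs_re_le_norm (sinCurve s)
  rw [sinCurve_re, norm_sinCurve] at h1
  have h2 := Complex.norm_sin_le_cosh (sinCurve s)
  rw [sinCurve_im] at h2
  exact h1.trans (h2.trans (Real.cosh_le_exp (sinCurveHeight_nonneg s)))

/-- On the curve sinh y ≤ |s| + y, so e^y/2 ≤ |s| + y + 1/2, and y ≥ 8 gives y + 1/2 ≤ e^y/4. -/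
theorem exp_sinCurveHeight_le {s : ℝ} (hs : 8 ≤ sinCurveHeight s) :
    Real.exp (sinCurveHeight s) ≤ 4 * |s| := by
  set y := sinCurveHeight s with hy
  have h1 : Real.sinh y ^ 2 - y ^ 2 = s ^ 2 - Real.sin s ^ 2 := by
    rw [← sinhSqSub_of_nonneg (by linarith), hy, sinhSqSub_sinCurveHeight]
  have h2 : Real.sinh y ≤ |s| + y := by
    refine abs_le_of_sq_le_sq' ?_ (by positivity) |>.2
    have := sq_abs s
    nlinarith [sq_nonneg (Real.sin s), mul_nonneg (abs_nonneg s) (by linarith : (0 : ℝ) ≤ y)]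
  have h3 := Real.quadratic_le_exp_of_nonneg (by linarith : (0 : ℝ) ≤ y)
  have h4 : Real.exp (-y) ≤ 1 := Real.exp_le_one_iff.2 (by linarith)
  rw [Real.sinh_eq] at h2
  nlinarith

theorem tendsto_sinCurveHeight_of_abs {F : Filter ℝ} (hF : Tendsto (fun s : ℝ => |s|) F atTop) :
    Tendsto sinCurveHeight F atTop := by
  refine tendsto_atTop_mono' F ?_ (Real.tendsto_log_atTop.comp hF)
  filter_upwards [hF.eventually_gt_atTop 0] with s hs
  exact (Real.log_le_iff_le_exp hs).2 (abs_le_exp_sinCurveHeight s)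

/-- The image of the curve `|sin w| = |w|` in the parameter plane follows the exponential
curves. -/
theorem followsExpCurve_fixedPointParam_sinCurve {F : Filter ℝ} {ε : ℝ}
    (hF : Tendsto (fun s : ℝ => ε * s) F atTop) (hε : |ε| = 1) :
    FollowsExpCurve (fun s => fixedPointParam (sinCurve s)) F atTop (-ε) := by
  have habs : ∀ᶠ s in F, ε * s = |s| := by
    filter_upwards [hF.eventually_ge_atTop 0] with s hs
    rw [← abs_of_nonneg hs, abs_mul, hε, one_mul]
  have hF' : Tendsto (fun s : ℝ => |s|) F atTop := hF.congr' habs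
  have hy := tendsto_sinCurveHeight_of_abs hF'
  have hmain : ∀ᶠ s in F, 8 ≤ sinCurveHeight s ∧
      |(fixedPointParam (sinCurve s)).re - sinCurveHeight s / 2| ≤ 2 ∧
      |(fixedPointParam (sinCurve s)).im + s / 2| ≤ 2 := by
    filter_upwards [hy.eventually_ge_atTop 8] with s hs
    have h1 := norm_fixedPointParam_add_le (norm_sinCurve s).le (by rw [sinCurve_im]; linarith)
    refine ⟨hs, ?_, ?_⟩
    · refine le_trans (le_of_eq ?_) ((Complex.abs_re_le_norm _).trans h1)
      congr 1
      have : (Complex.I * sinCurve s / 2).re = -sinCurveHeight s / 2 := by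
        simp
      rw [Complex.add_re, this]; ring
    · refine le_trans (le_of_eq ?_) ((Complex.abs_im_le_norm _).trans h1)
      congr 1
      have : (Complex.I * sinCurve s / 2).im = s / 2 := by
        simp
      rw [Complex.add_im, this]
  -- Since |2 Re λ - y| ≤ 4, the numbers e^{2 Re λ} and e^y differ by a factor at most e^4; and
  -- e^y/16 ≤ |s|/2 - 2, |s|/2 + 2 ≤ e^y once e^y ≥ 40.
  refine ⟨?_, Real.exp (-4) / 16, Real.exp 4, by positivity, by positivity, ?_⟩
  · refine tendsto_atTop_mono' F (f₁ := fun s => sinCurveHeight s / 2 - 2) ?_ ?_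
    · filter_upwards [hmain] with s hs
      have := (abs_le.1 hs.2.1).1
      linarith
    · exact tendsto_atTop_add_const_right F _ (hy.atTop_div_const two_pos)
  · filter_upwards [hmain, habs] with s ⟨hs, hre, him⟩ hes
    set g := fixedPointParam (sinCurve s)
    obtain ⟨hre1, hre2⟩ := abs_le.1 hre
    have him' : |ε * g.im + |s| / 2| ≤ 2 := by
      have : ε * g.im + |s| / 2 = ε * (g.im + s / 2) := by rw [← hes]; ring
      rwa [this, abs_mul, hε, one_mul]
    obtain ⟨him1, him2⟩ := abs_le.1 him'
    have hu := exp_sinCurveHeight_le hs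
    have hl := abs_le_exp_sinCurveHeight s
    have h40 : 40 ≤ Real.exp (sinCurveHeight s) := by
      have := Real.quadratic_le_exp_of_nonneg (by linarith : (0 : ℝ) ≤ sinCurveHeight s)
      nlinarith
    rw [abs_of_nonneg (by linarith : 0 ≤ 2 * g.re)]
    have e1 : Real.exp (2 * g.re) ≤ Real.exp 4 * Real.exp (sinCurveHeight s) := by
      rw [← Real.exp_add]; exact Real.exp_le_exp.2 (by linarith)
    have e2 : Real.exp (-4) * Real.exp (sinCurveHeight s) ≤ Real.exp (2 * g.re) := by
      rw [← Real.exp_add]; exact Real.exp_le_exp.2 (by linarith)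
    have e3 : Real.exp (-4) * Real.exp 4 = 1 := by rw [← Real.exp_add]; norm_num
    have p1 := Real.exp_pos (-4)
    have p2 := Real.exp_pos 4
    constructor
    · have : Real.exp (-4) * Real.exp (2 * g.re) ≤ Real.exp (sinCurveHeight s) := by
        calc _ ≤ Real.exp (-4) * (Real.exp 4 * Real.exp (sinCurveHeight s)) := by gcongr
          _ = _ := by rw [← mul_assoc, e3, one_mul]
      linarith
    · have : Real.exp (sinCurveHeight s) ≤ Real.exp 4 * Real.exp (2 * g.re) := by
        calc _ = Real.exp 4 * (Real.exp (-4) * Real.exp (sinCurveHeight s)) := by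
              rw [← mul_assoc, mul_comm (Real.exp 4), e3, one_mul]
          _ ≤ _ := by gcongr
      linarith

theorem FollowsExpCurve.comp_neg {γ : ℝ → ℂ} {F G R : Filter ℝ} {ε : ℝ}
    (h : FollowsExpCurve γ F R ε) (hG : Tendsto (fun s : ℝ => -s) G F) :
    FollowsExpCurve (fun s => γ (-s)) G R ε := by
  obtain ⟨h1, c, C, hc, hC, h2⟩ := h
  exact ⟨h1.comp hG, c, C, hc, hC, hG.eventually h2⟩

theorem FollowsExpCurve.neg {γ : ℝ → ℂ} {F : Filter ℝ} {ε : ℝ}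
    (h : FollowsExpCurve γ F atTop ε) : FollowsExpCurve (fun s => -γ s) F atBot (-ε) := by
  obtain ⟨h1, c, C, hc, hC, h2⟩ := h
  refine ⟨tendsto_neg_atTop_atBot.comp h1, c, C, hc, hC, ?_⟩
  simpa using h2

theorem boundaryFollowsExpCurves_nonzeroFixedParameters :
    BoundaryFollowsExpCurves nonzeroFixedParameters atTop := by
  have h1 := followsExpCurve_fixedPointParam_sinCurve (F := atTop) (ε := 1)
    (by simpa using! tendsto_id) (by simp)
  have h2 := followsExpCurve_fixedPointParam_sinCurve (F := atBot) (ε := -1)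
    (by simpa using tendsto_neg_atBot_atTop) (by simp)
  rw [neg_neg] at h2
  -- Im λ ≈ -s/2, so the curve is reversed to end in the upper half plane as s → +∞.
  refine ⟨fun s => fixedPointParam (sinCurve (-s)),
    continuous_fixedPointParam_sinCurve.comp continuous_neg, ?_,
    h2.comp_neg tendsto_neg_atTop_atBot, h1.comp_neg tendsto_neg_atBot_atTop⟩
  rw [← range_fixedPointParam_sinCurve]
  exact neg_surjective.range_comp fun s => fixedPointParam (sinCurve s)

theorem boundaryFollowsExpCurves_neg_nonzeroFixedParameters :
    BoundaryFollowsExpCurves (-nonzeroFixedParameters) atBot := by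
  have h1 := followsExpCurve_fixedPointParam_sinCurve (F := atTop) (ε := 1)
    (by simpa using! tendsto_id) (by simp)
  have h2 := followsExpCurve_fixedPointParam_sinCurve (F := atBot) (ε := -1)
    (by simpa using tendsto_neg_atBot_atTop) (by simp)
  refine ⟨fun s => -fixedPointParam (sinCurve s), continuous_fixedPointParam_sinCurve.neg, ?_,
    by simpa using h1.neg, by simpa using h2.neg⟩
  have h3 : frontier (-nonzeroFixedParameters) = -frontier nonzeroFixedParameters :=
    ((Homeomorph.neg ℂ).preimage_frontier nonzeroFixedParameters).symm
  rw [h3, ← range_fixedPointParam_sinCurve, ← Set.image_neg_eq_neg, ← Set.range_comp]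
  rfl

/-! ### The two hyperbolic components -/

theorem hyperbolicParameters_neg {lam : ℂ} (h : lam ∈ hyperbolicParameters) :
    -lam ∈ hyperbolicParameters := by
  obtain ⟨h0, p, z, hz⟩ := h
  obtain ⟨q, hq⟩ := hz.neg_param
  exact ⟨neg_ne_zero.2 h0, q, z, hq⟩

theorem IsHyperbolicComponent.eq_of_mem {Ω A : Set ℂ} {lam : ℂ} (hΩ : IsHyperbolicComponent Ω)
    (hA : connectedComponentIn hyperbolicParameters lam = A) (h : lam ∈ Ω) : Ω = A := by
  obtain ⟨l, -, rfl⟩ := hΩ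
  rw [← hA, connectedComponentIn_eq h]

theorem connectedComponentIn_of_mem_nonzeroFixedParameters {lam : ℂ}
    (h : lam ∈ nonzeroFixedParameters) :
    connectedComponentIn hyperbolicParameters lam = nonzeroFixedParameters :=
  connectedComponentIn_eq_of_clopen isPreconnected_nonzeroFixedParameters
    isOpen_nonzeroFixedParameters nonzeroFixedParameters_subset
    closure_nonzeroFixedParameters_inter h

theorem connectedComponentIn_of_mem_neg_nonzeroFixedParameters {lam : ℂ}
    (h : lam ∈ -nonzeroFixedParameters) :
    connectedComponentIn hyperbolicParameters lam = -nonzeroFixedParameters := by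
  refine connectedComponentIn_eq_of_clopen ?_ isOpen_nonzeroFixedParameters.neg
    (fun l hl => ?_) ?_ h
  · rw [← Set.image_neg_eq_neg]
    exact isPreconnected_nonzeroFixedParameters.image _ continuous_neg.continuousOn
  · simpa using hyperbolicParameters_neg (nonzeroFixedParameters_subset hl)
  · rintro l ⟨hl, hl'⟩
    have h1 : closure (-nonzeroFixedParameters) = -closure nonzeroFixedParameters :=
      ((Homeomorph.neg ℂ).preimage_closure nonzeroFixedParameters).symm
    rw [h1] at hl
    exact closure_nonzeroFixedParameters_inter ⟨hl, hyperbolicParameters_neg hl'⟩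

/-! ### Asymptotic values -/

theorem IsAsymptoticValue.neg {lam v : ℂ} (h : IsAsymptoticValue lam v) :
    IsAsymptoticValue lam (-v) := by
  obtain ⟨α, h1, h2, h3, h4⟩ := h
  refine ⟨fun t => -α t, h1.neg, by simpa using h2, by simpa using h3, ?_⟩
  simpa [tanFamily_neg] using h4.neg

theorem tendsto_tanh_atTop_nhds_one : Tendsto Real.tanh atTop (𝓝 1) := by
  have h1 : Tendsto (fun t : ℝ => Real.exp (-2 * t)) atTop (𝓝 0) :=
    Real.tendsto_exp_atBot.comp (tendsto_id.const_mul_atTop_of_neg (by norm_num))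
  have h2 : Tendsto (fun t : ℝ => (1 - Real.exp (-2 * t)) / (1 + Real.exp (-2 * t))) atTop
      (𝓝 ((1 - 0) / (1 + 0))) :=
    (tendsto_const_nhds.sub h1).div (tendsto_const_nhds.add h1) (by norm_num)
  simp only [sub_zero, add_zero, div_one] at h2
  refine h2.congr fun t => ?_
  have h3 : Real.exp (-t) = Real.exp t * Real.exp (-2 * t) := by
    rw [← Real.exp_add]; ring_nf
  rw [Real.tanh_eq, h3]
  have := Real.exp_pos t
  have := Real.exp_pos (-2 * t)
  field_simp

theorem isAsymptoticValue_mul_I (lam : ℂ) : IsAsymptoticValue lam (lam * Complex.I) := by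
  refine ⟨fun t => t * Complex.I, by fun_prop, ?_, Eventually.of_forall fun t => ?_, ?_⟩
  · simpa using tendsto_abs_atTop_atTop
  · rw [Complex.cos_mul_I, ← Complex.ofReal_cosh]
    exact Complex.ofReal_ne_zero.2 (Real.cosh_pos t).ne'
  · have h1 : Tendsto (fun t : ℝ => lam * ((Real.tanh t : ℝ) * Complex.I)) atTop
        (𝓝 (lam * ((1 : ℝ) * Complex.I))) :=
      (((Complex.continuous_ofReal.tendsto 1).comp tendsto_tanh_atTop_nhds_one).mul_const _).const_mul
        lam
    simp only [Complex.ofReal_one, one_mul] at h1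
    refine h1.congr fun t => ?_
    rw [tanFamily, Complex.tan_mul_I, Complex.ofReal_tanh]

/-- A path along which the exponential function has a nonzero limit does not tend to infinity. -/
theorem not_tendsto_norm_of_tendsto_exp {β : ℝ → ℂ} {κ : ℂ} (hκ : κ ≠ 0)
    (hβ : ContinuousOn β (Set.Ici 0)) (hlim : Tendsto (fun t => Complex.exp (β t)) atTop (𝓝 κ)) :
    ¬ Tendsto (fun t => ‖β t‖) atTop atTop := by
  have hlim1 : Tendsto (fun t => Complex.exp (β t) / κ) atTop (𝓝 1) := by
    simpa [hκ] using hlim.div_const κ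
  have hslit : ∀ᶠ t in atTop, Complex.exp (β t) / κ ∈ Complex.slitPlane :=
    hlim1.eventually (Complex.isOpen_slitPlane.mem_nhds (by simp))
  obtain ⟨T, hT⟩ := eventually_atTop.1 (hslit.and (eventually_ge_atTop 0))
  have hcont : ContinuousOn (fun t => β t - Complex.log (Complex.exp (β t) / κ)) (Set.Ici T) := by
    have hβT := hβ.mono (Set.Ici_subset_Ici.2 (hT T le_rfl).2)
    exact hβT.sub ((hβT.cexp.div_const κ).clog fun t ht => (hT t ht).1)
  -- A continuous logarithm of the constant κ: its values differ by multiples of 2πi, so it is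
  -- constant and β converges.
  set g : ℝ → ℂ := fun t => β t - Complex.log (Complex.exp (β t) / κ) with hg
  have hexp : ∀ t, Complex.exp (g t) = κ := by
    intro t
    rw [hg]
    simp only
    rw [Complex.exp_sub, Complex.exp_log (div_ne_zero (Complex.exp_ne_zero _) hκ)]
    field_simp [Complex.exp_ne_zero]
  have hint : ∀ t, ∃ n : ℤ, g t = g T + n * (2 * Real.pi * Complex.I) := fun t =>
    Complex.exp_eq_exp_iff_exists_int.1 ((hexp t).trans (hexp T).symm)
  choose n hn using hint
  have hncont : ContinuousOn n (Set.Ici T) := by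
    rw [Int.isClosedEmbedding_coe_real.isInducing.continuousOn_iff]
    have h1 : ContinuousOn (fun t => ((g t - g T) / (2 * Real.pi * Complex.I)).re) (Set.Ici T) :=
      Complex.continuous_re.comp_continuousOn ((hcont.sub continuousOn_const).div_const _)
    refine h1.congr fun t _ => ?_
    have h2 : (g t - g T) / (2 * Real.pi * Complex.I) = n t := by
      rw [hn t, add_sub_cancel_left, mul_div_cancel_right₀ _ Complex.two_pi_I_ne_zero]
    simp only [h2, Function.comp_apply, Complex.intCast_re]
  have hconst : ∀ t ∈ Set.Ici T, g t = g T := by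
    intro t ht
    have h1 := isPreconnected_Ici.constant hncont ht (Set.mem_Ici.2 le_rfl)
    rw [hn t, h1, ← hn T]
  have hconv : Tendsto β atTop (𝓝 (g T + Complex.log 1)) := by
    have h1 : Tendsto (fun t => g T + Complex.log (Complex.exp (β t) / κ)) atTop
        (𝓝 (g T + Complex.log 1)) :=
      tendsto_const_nhds.add ((continuousAt_clog (by simp)).tendsto.comp hlim1)
    refine h1.congr' ?_
    filter_upwards [eventually_ge_atTop T] with t ht
    rw [← hconst t ht, hg]
    simp
  exact not_tendsto_atTop_of_tendsto_nhds hconv.norm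

/-- For any other v, the Möbius relation between tan α and e^{2iα} gives e^{2iα} a finite nonzero
limit, so α cannot tend to infinity. -/
theorem eq_or_eq_of_isAsymptoticValue {lam v : ℂ} (hlam : lam ≠ 0)
    (h : IsAsymptoticValue lam v) : v = lam * Complex.I ∨ v = -(lam * Complex.I) := by
  obtain ⟨α, h1, h2, h3, h4⟩ := h
  by_contra! hcon
  have hI := Complex.I_sq
  have hnum : 1 + Complex.I * (v / lam) ≠ 0 := by
    intro h0
    apply hcon.1
    field_simp at h0
    linear_combination -Complex.I * h0 + v * hI
  have hden : 1 - Complex.I * (v / lam) ≠ 0 := by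
    intro h0
    apply hcon.2
    field_simp at h0
    linear_combination Complex.I * h0 + v * hI
  have htan : Tendsto (fun t => Complex.tan (α t)) atTop (𝓝 (v / lam)) := by
    refine (h4.div_const lam).congr fun t => ?_
    rw [tanFamily, mul_div_cancel_left₀ _ hlam]
  have hlim : Tendsto (fun t => (1 + Complex.I * Complex.tan (α t)) /
      (1 - Complex.I * Complex.tan (α t))) atTop
      (𝓝 ((1 + Complex.I * (v / lam)) / (1 - Complex.I * (v / lam)))) :=
    ((htan.const_mul _).const_add 1).div ((htan.const_mul _).const_sub 1) hden
  refine not_tendsto_norm_of_tendsto_exp (div_ne_zero hnum hden)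
    (β := fun t => 2 * Complex.I * α t) (by fun_prop) (hlim.congr' ?_) ?_
  · filter_upwards [h3, ((htan.const_mul Complex.I).const_sub 1).eventually_ne hden] with t ht ht'
    rw [div_eq_iff ht']
    exact ((exp_mul_eq_iff _ _).2 (Complex.tan_mul_cos ht).symm).symm
  · simpa using h2.const_mul_atTop two_pos

/-! ### Symmetric cycles of period two -/

theorem IsAttractedTo.neg_param {lam v z : ℂ} (h : IsAttractedTo lam v {z}) :
    IsAttractedTo (-lam) v {z, -z} := by
  refine ⟨h.1.neg_param, squeeze_zero (fun _ => Metric.infDist_nonneg) (fun n => ?_) h.2⟩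
  rw [Metric.infDist_singleton, tanFamily_neg_param_iterate]
  rcases neg_one_pow_eq_or ℂ n with hn | hn
  · rw [hn, one_mul]
    exact Metric.infDist_le_dist_of_mem (by simp)
  · rw [hn, neg_one_mul, ← dist_neg_neg]
    exact Metric.infDist_le_dist_of_mem (by simp)

theorem forwardOrbit_of_eq_neg {lam z : ℂ} (h : tanFamily lam z = -z) :
    forwardOrbit lam z = {z, -z} := by
  have h1 : ∀ n, (tanFamily lam)^[n] z = (-1) ^ n * z := by
    intro n
    induction n with
    | zero => simp
    | succ n ih =>
      rw [Function.iterate_succ_apply', ih, pow_succ]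
      rcases neg_one_pow_eq_or ℂ n with hn | hn <;> simp [hn, h, tanFamily_neg]
  ext w
  constructor
  · rintro ⟨n, rfl⟩
    simp only [h1]
    rcases neg_one_pow_eq_or ℂ n with hn | hn <;> simp [hn]
  · rintro (rfl | rfl)
    · exact ⟨0, rfl⟩
    · exact ⟨1, by simp [h]⟩

/-- If f_{-λ} fixes z then f_λ swaps z and -z. Attracting points and attracted orbits carry over
between λ and -λ, so uniqueness and the capture of both asymptotic values do too. -/
theorem exists_unique_cycle_of_mem_neg {lam : ℂ} (hlam : lam ∈ -nonzeroFixedParameters) :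
    ∃ C : Set ℂ, IsAttractingCycle lam 2 C ∧
      (∀ (p : ℕ) (C' : Set ℂ), IsAttractingCycle lam p C' → C' = C) ∧
      ∀ v : ℂ, IsAsymptoticValue lam v → IsAttractedTo lam v C := by
  obtain ⟨z, hz, h⟩ := hlam
  have hne : z ≠ -z := fun h' => hz (self_eq_neg.1 h')
  have hlam0 : lam ≠ 0 := neg_ne_zero.1 (param_ne_zero_of_fixed hz h.iterate_eq)
  have hf : tanFamily lam z = -z := by
    have h1 : tanFamily (-lam) z = z := h.iterate_eq
    rw [tanFamily, neg_mul] at h1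
    exact neg_eq_iff_eq_neg.1 h1
  have horb := forwardOrbit_of_eq_neg hf
  have hf2 : Function.IsPeriodicPt (tanFamily lam) 2 z := by
    change tanFamily lam (tanFamily lam z) = z
    rw [hf, tanFamily_neg, hf, neg_neg]
  have hmin : Function.minimalPeriod (tanFamily lam) z = 2 := by
    rcases (Nat.dvd_prime Nat.prime_two).1 hf2.minimalPeriod_dvd with h1 | h1
    · exact absurd ((Function.minimalPeriod_eq_one_iff_isFixedPt.1 h1).symm.trans hf) hne
    · exact h1
  obtain ⟨q, hq⟩ := h.neg_param
  rw [neg_neg] at hq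
  have hq2 : q = 2 := hq.2.2.1.symm.trans hmin
  subst hq2
  refine ⟨{z, -z}, ⟨z, hq, horb.symm⟩, ?_, ?_⟩
  · rintro p _ ⟨w, hw, rfl⟩
    obtain ⟨q, hw'⟩ := hw.neg_param
    rcases eq_or_eq_neg_of_attracting_fixed hz h hw' with rfl | rfl
    · exact horb
    · change forwardOrbit lam (-z) = _
      rw [forwardOrbit_neg, horb]
      ext u
      simp [or_comm]
  · have hatt : ∀ v, IsAttractedTo (-lam) v {z} ∨ IsAttractedTo (-lam) v {-z} →
        IsAttractedTo lam v {z, -z} := by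
      rintro v (hv | hv)
      · simpa using hv.neg_param
      · simpa [Set.pair_comm] using hv.neg_param
    have hcases := attracted_of_attracting_fixed hz h
    simp only [neg_mul, neg_neg] at hcases
    intro v hv
    apply hatt
    rcases eq_or_eq_of_isAsymptoticValue hlam0 hv with rfl | rfl <;> tauto

/-- The cycles of z and -z both attract λi, so they coincide. As z ≠ 0 and the period is two, f_λ(z)
= -z, and z is fixed by f_{-λ}. -/
theorem mem_neg_of_attracts_asymptoticValues {lam : ℂ} {C : Set ℂ}
    (hC : IsAttractingCycle lam 2 C)
    (h : ∀ v : ℂ, IsAsymptoticValue lam v → IsAttractedTo lam v C) :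
    lam ∈ -nonzeroFixedParameters := by
  obtain ⟨z, hz, rfl⟩ := hC
  have h1 : IsAttractedTo lam (lam * Complex.I) (forwardOrbit lam z) :=
    h _ (isAsymptoticValue_mul_I lam)
  have h2 : IsAttractedTo lam (lam * Complex.I) (forwardOrbit lam (-z)) := by
    have := (h _ (isAsymptoticValue_mul_I lam).neg).neg
    rw [neg_neg] at this
    rw [forwardOrbit_neg]
    exact this
  obtain ⟨n, hn⟩ := mem_forwardOrbit_of_isAttractedTo hz hz.neg h1 h2
  simp only at hn
  have hz0 : z ≠ 0 := by
    rintro rfl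
    have h3 : Function.minimalPeriod (tanFamily lam) 0 = 1 :=
      Function.minimalPeriod_eq_one_iff_isFixedPt.2 (by simp [Function.IsFixedPt, tanFamily])
    have := hz.2.2.1
    omega
  have hf : tanFamily lam z = -z := by
    have h3 := Function.IsPeriodicPt.iterate_mod_apply (f := tanFamily lam) hz.iterate_eq n
    rw [hn] at h3
    rcases Nat.mod_two_eq_zero_or_one n with h4 | h4
    · rw [h4] at h3
      exact absurd (self_eq_neg.1 h3) hz0
    · rw [h4] at h3
      exact h3
  obtain ⟨q, hq⟩ := hz.neg_param
  have hq1 : q = 1 := by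
    rw [← hq.2.2.1]
    refine Function.minimalPeriod_eq_one_iff_isFixedPt.2 ?_
    have h5 : tanFamily (-lam) z = -tanFamily lam z := by rw [tanFamily, tanFamily, neg_mul]
    rw [Function.IsFixedPt, h5, hf, neg_neg]
  exact ⟨z, hz0, hq1 ▸ hq⟩

theorem mainTheorem6 :
    ∃ Ω₁ Ω₂ : Set ℂ,
      (IsHyperbolicComponent Ω₁ ∧ ∀ t : ℝ, 1 < t → (t : ℂ) ∈ Ω₁) ∧
      (IsHyperbolicComponent Ω₂ ∧ ∀ t : ℝ, t < -1 → (t : ℂ) ∈ Ω₂) ∧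
      (∀ lam ∈ Ω₁, (attractingFixedPoints lam).encard = 2) ∧
      (∀ Ω : Set ℂ, IsHyperbolicComponent Ω →
        (∃ lam ∈ Ω, 2 ≤ (attractingFixedPoints lam).encard) → Ω = Ω₁) ∧
      (∀ lam ∈ Ω₂, ∃ C : Set ℂ, IsAttractingCycle lam 2 C ∧
        (∀ (p : ℕ) (C' : Set ℂ), IsAttractingCycle lam p C' → C' = C) ∧
        ∀ v : ℂ, IsAsymptoticValue lam v → IsAttractedTo lam v C) ∧
      (∀ Ω : Set ℂ, IsHyperbolicComponent Ω →
        (∃ lam ∈ Ω, ∃ C : Set ℂ, IsAttractingCycle lam 2 C ∧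
          ∀ v : ℂ, IsAsymptoticValue lam v → IsAttractedTo lam v C) → Ω = Ω₂) ∧
      BoundaryFollowsExpCurves Ω₁ atTop ∧
      BoundaryFollowsExpCurves Ω₂ atBot := by
  have hneg : ∀ t : ℝ, t < -1 → (t : ℂ) ∈ -nonzeroFixedParameters := by
    intro t ht
    have := ofReal_mem_nonzeroFixedParameters (t := -t) (by linarith)
    rwa [Complex.ofReal_neg] at this
  have h2 : ((2 : ℝ) : ℂ) ∈ nonzeroFixedParameters :=
    ofReal_mem_nonzeroFixedParameters one_lt_two
  have h2' : ((-2 : ℝ) : ℂ) ∈ -nonzeroFixedParameters := hneg _ (by norm_num)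
  refine ⟨nonzeroFixedParameters, -nonzeroFixedParameters,
    ⟨⟨_, nonzeroFixedParameters_subset h2,
      (connectedComponentIn_of_mem_nonzeroFixedParameters h2).symm⟩,
      fun t ht => ofReal_mem_nonzeroFixedParameters ht⟩,
    ⟨⟨((-2 : ℝ) : ℂ), ?_, (connectedComponentIn_of_mem_neg_nonzeroFixedParameters h2').symm⟩, hneg⟩,
    fun lam h => encard_attractingFixedPoints h, ?_,
    fun lam h => exists_unique_cycle_of_mem_neg h, ?_,
    boundaryFollowsExpCurves_nonzeroFixedParameters,
    boundaryFollowsExpCurves_neg_nonzeroFixedParameters⟩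
  · simpa using hyperbolicParameters_neg (nonzeroFixedParameters_subset h2')
  · rintro Ω hΩ ⟨lam, hlam, h⟩
    exact hΩ.eq_of_mem (connectedComponentIn_of_mem_nonzeroFixedParameters
      (mem_nonzeroFixedParameters_of_two_le h)) hlam
  · rintro Ω hΩ ⟨lam, hlam, C, hC, h⟩
    exact hΩ.eq_of_mem (connectedComponentIn_of_mem_neg_nonzeroFixedParameters
      (mem_neg_of_attracts_asymptoticValues hC h)) hlam
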